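/- Let $\mathbb K$ be a field of characteristic $0$ or $\mathbb K=\mathbb Z$, and let $n,m\ge 0$. Let $\mathbb P=\mathrm{Trop}(Z_1,\dots,Z_m)$ be the tropical semifield, i.e. the free multiplicative abelian group on $Z_1,\dots,Z_m$ with $\prod_i Z_i^{a_i}\oplus\prod_i Z_i^{b_i}=\prod_i Z_i^{\min(a_i,b_i)}$. Let $\mathbb{KP}=\mathbb K[Z_1^{\pm1},\dots,Z_m^{\pm1}]$ be its group ring over $\mathbb K$ and $\mathcal F$ a field of rational functions in $n$ independent variables with coefficients in $\mathbb{KP}$. A seed is a triple $t=(B,X,A)$, where $B=(b_{ij})$ is a skew-symmetrizable $n\times n$ integer matrix (there is an integer diagonal matrix $S$ with strictly positive diagonal entries such that $SB$ is skew-symmetric), $X=(X_1,\dots,X_n)\in\mathbb P^n$, and the cluster variables $A_1,\dots,A_n\in\mathcal F$ are algebraically independent over $\mathbb{KP}$ and generate $\mathcal F$ over $\mathbb{KP}$ as a field. Its $k$-th exchange binomial is $$P_{k;t}=\frac{X_k}{1\oplus X_k}\prod_{b_{jk}>0}A_j^{b_{jk}}+\frac1{1\oplus X_k}\prod_{b_{jk}<0}A_j^{-b_{jk}}.$$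 The mutation $\mu_k(t)=(B',X',A')$ is given by $b'_{ij}=-b_{ij}$ if $i=k$ or $j=k$ and $b'_{ij}=b_{ij}+\mathrm{sgn}(b_{ik})\max(b_{ik}b_{kj},0)$ otherwise; $X'_k=X_k^{-1}$ and $X'_i=X_iX_k^{\max(b_{ki},0)}(1\oplus X_k)^{-b_{ki}}$ for $i\ne k$; $A'_k=A_k^{-1}P_{k;t}$ and $A'_i=A_i$ for $i\neq k$. Let $t_0$ be a seed, with cluster variables $A_{1;t_0},\dots,A_{n;t_0}$. The upper cluster algebra with initial seed $t_0$ is $\mathcal U=\bigcap_t\mathcal L(t)\subseteq\mathcal F$, where $t$ runs over all seeds obtained from $t_0$ by finite sequences of mutations and $\mathcal L(t)=\mathbb{KP}[A_{1;t}^{\pm1},\dots,A_{n;t}^{\pm1}]$. Write $X_{j;t_0}=\prod_i Z_i^{c_{ij}}$ and $C=(c_{ij})$, and assume that $\mathcal U$ is of full rank, i.e. that the $(n+m)\times n$ extended exchange matrix $\binom{B_{t_0}}{C}$ has rank $n$. For $M\in\mathcal U$ let $(A_{k;t_0}\|M)_v=\max\{s\in\mathbb N\mid M/A_{k;t_0}^s\in\mathcal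 U\}\in\mathbb N\cup\{\infty\}$. Then every $A_{k;t_0}$ lies in $\mathcal U$, every $P_{k;t_0}$ lies in the subring $\mathbb K[Z_1,\dots,Z_m][A_{1;t_0},\dots,\widehat{A_{k;t_0}},\dots,A_{n;t_0}]$ of $\mathcal F$ (with $A_{k;t_0}$ omitted), and the following statements are equivalent. (i) $\mathcal U$ is factorial (a unique factorization domain). (ii) For every $k$, the initial cluster variable $A_{k;t_0}$ is prime in $\mathcal U$. (iii) For every $k$ and all non-zero $M,L\in\mathcal U$, $(A_{k;t_0}\|M\cdot L)_v=(A_{k;t_0}\|M)_v+(A_{k;t_0}\|L)_v$. (iv) For every $k$, the exchange binomial $P_{k;t_0}$ is irreducible in $\mathbb K[Z_1,\dots,Z_m][A_{1;t_0},\dots,\widehat{A_{k;t_0}},\dots,A_{n;t_0}]$. -/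

import Mathlib

namespace ClusterAlgebra

/-- Auxiliary addition making an abelian multiplicative group a semifield: `⊕` is commutative,
associative, and multiplication distributes over it. -/
class AuxAddition (P : Type*) [CommGroup P] where
  oplus : P → P → P
  oplus_comm : ∀ a b, oplus a b = oplus b a
  oplus_assoc : ∀ a b c, oplus (oplus a b) c = oplus a (oplus b c)
  mul_oplus : ∀ a b c, a * oplus b c = oplus (a * b) (a * c)

/-- The free abelian multiplicative group on `Z_1, …, Z_m`; the exponent vector of `p` is
`Multiplicative.toAdd p`. -/
abbrev Trop (m : ℕ) : Type := Multiplicative (Fin m → ℤ)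

/-- The tropical semifield structure: `∏ Z_i ^ a_i ⊕ ∏ Z_i ^ b_i = ∏ Z_i ^ min (a_i, b_i)`. -/
instance tropAuxAddition (m : ℕ) : AuxAddition (Trop m) where
  oplus a b := Multiplicative.ofAdd fun i => min (a.toAdd i) (b.toAdd i)
  oplus_comm _ _ := congrArg Multiplicative.ofAdd (funext fun _ => min_comm _ _)
  oplus_assoc _ _ _ := congrArg Multiplicative.ofAdd (funext fun _ => min_assoc _ _ _)
  mul_oplus _ _ _ := congrArg Multiplicative.ofAdd (funext fun _ => add_min _ _ _)

/-- The generator `Z_i` of the tropical semifield. -/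
def Trop.gen {m : ℕ} (i : Fin m) : Trop m := Multiplicative.ofAdd (Pi.single i 1)

/-- `B` is skew-symmetrizable: `S * B` is skew-symmetric for some integer diagonal matrix `S` with
strictly positive diagonal entries. -/
def IsSkewSymmetrizable {n : ℕ} (B : Matrix (Fin n) (Fin n) ℤ) : Prop :=
  ∃ d : Fin n → ℤ, (∀ i, 0 < d i) ∧
    (Matrix.diagonal d * B).transpose = -(Matrix.diagonal d * B)

/-- Mutation of the exchange matrix at `k`. -/
def mutateMatrix {n : ℕ} (B : Matrix (Fin n) (Fin n) ℤ) (k : Fin n) :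
    Matrix (Fin n) (Fin n) ℤ :=
  Matrix.of fun i j =>
    if i = k ∨ j = k then -B i j
    else B i j + Int.sign (B i k) * max (B i k * B k j) 0

/-- The data `(B, X, A)` of a labeled `𝒜`-seed of rank `n` over `P` in the field `F`. -/
@[ext] structure SeedData (n : ℕ) (P F : Type*) where
  B : Matrix (Fin n) (Fin n) ℤ
  X : Fin n → P
  A : Fin n → F

namespace SeedData

section General

variable {n : ℕ} {P F : Type*} [CommGroup P] [AuxAddition P] [Field F]

/-- `(B, X, A)` is a labeled `𝒜`-seed: `B` is skew-symmetrizable and `A` is a free generating set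
of `F` over `KP`, i.e. the `A_i` are algebraically independent over the group ring `KP` and
generate `F` as a field over it. In particular `F` is then a field of rational functions in `n`
independent variables with coefficients in `KP`. -/
structure IsSeed (K : Type*) [CommRing K] [Algebra (MonoidAlgebra K P) F]
    (t : SeedData n P F) : Prop where
  skew : IsSkewSymmetrizable t.B
  algebraicIndependent : AlgebraicIndependent (MonoidAlgebra K P) t.A
  generates : Subfield.closure
    (Set.range (algebraMap (MonoidAlgebra K P) F) ∪ Set.range t.A) = ⊤

/-- The `k`-th exchange binomial
`X_k / (1 ⊕ X_k) * ∏_{b_jk > 0} A_j ^ b_jk + 1 / (1 ⊕ X_k) * ∏_{b_jk < 0} A_j ^ (-b_jk)`,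
an element of `F`. -/
noncomputable def exchangeBinomial (K : Type*) [CommRing K] [Algebra (MonoidAlgebra K P) F]
    (t : SeedData n P F) (k : Fin n) : F :=
  algebraMap (MonoidAlgebra K P) F
      (MonoidAlgebra.of K P (t.X k / AuxAddition.oplus 1 (t.X k))) *
      ∏ j with 0 < t.B j k, t.A j ^ t.B j k +
    algebraMap (MonoidAlgebra K P) F
      (MonoidAlgebra.of K P (1 / AuxAddition.oplus 1 (t.X k))) *
      ∏ j with t.B j k < 0, t.A j ^ (-t.B j k)

/-- Seed mutation at `k`. -/
noncomputable def mutate (K : Type*) [CommRing K] [Algebra (MonoidAlgebra K P) F]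
    (t : SeedData n P F) (k : Fin n) : SeedData n P F where
  B := mutateMatrix t.B k
  X i :=
    if i = k then (t.X k)⁻¹
    else t.X i * t.X k ^ max (t.B k i) 0 * AuxAddition.oplus 1 (t.X k) ^ (-t.B k i)
  A i := if i = k then (t.A k)⁻¹ * t.exchangeBinomial K k else t.A i

/-- `t` occurs in the seed pattern with initial seed `t₀`. A vertex of the `n`-regular tree is the
endpoint of a walk from the initial vertex, and the walk is given by its sequence of edge labels,
so these are the seeds obtained from `t₀` by finite sequences of mutations. -/
def InPattern (K : Type*) [CommRing K] [Algebra (MonoidAlgebra K P) F]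
    (t₀ t : SeedData n P F) : Prop :=
  ∃ w : List (Fin n), t = w.foldl (fun s k => s.mutate K k) t₀

/-- The Laurent polynomial ring `ℒ(t) = KP[A_1^{±1}, …, A_n^{±1}]` inside `F`. -/
noncomputable def laurentRing (K : Type*) [CommRing K] [Algebra (MonoidAlgebra K P) F]
    (t : SeedData n P F) : Subalgebra (MonoidAlgebra K P) F :=
  Algebra.adjoin (MonoidAlgebra K P) (Set.range t.A ∪ Set.range fun i => (t.A i)⁻¹)

/-- The upper cluster algebra with initial seed `t₀`: the intersection of the rings `ℒ(t)` over
all seeds `t` of the seed pattern. -/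
noncomputable def upperClusterAlgebra (K : Type*) [CommRing K] [Algebra (MonoidAlgebra K P) F]
    (t₀ : SeedData n P F) : Subalgebra (MonoidAlgebra K P) F :=
  ⨅ (t : SeedData n P F) (_ : InPattern K t₀ t), t.laurentRing K

end General

section Geometric

variable {n m : ℕ} {F : Type*}

/-- The extended exchange matrix, with `B` on top of the coefficient matrix `C = (c_ij)`, where
`X_j = ∏ Z_i ^ c_ij`. -/
def extendedMatrix (t : SeedData n (Trop m) F) : Matrix (Fin n ⊕ Fin m) (Fin n) ℤ :=
  Matrix.fromRows t.B (Matrix.of fun i j => (t.X j).toAdd i)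

/-- The extended exchange matrix, of size `(n + m) × n`, has full rank `n`. -/
def IsFullRank (t : SeedData n (Trop m) F) : Prop :=
  (t.extendedMatrix.map (Int.cast : ℤ → ℚ)).rank = n

/-- The polynomial ring `K[Z_1, …, Z_m]` inside the group ring of the tropical semifield. -/
noncomputable def coeffPolyRing (K : Type*) [CommRing K] (m : ℕ) :
    Subalgebra K (MonoidAlgebra K (Trop m)) :=
  Algebra.adjoin K (Set.range fun i : Fin m => MonoidAlgebra.of K (Trop m) (Trop.gen i))

/-- The polynomial ring `K[Z_1, …, Z_m][A_1, …, Â_k, …, A_n]` (with `A_k` omitted) inside `F`. -/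
noncomputable def omitPolyRing (K : Type*) [CommRing K] [Field F] [Algebra (MonoidAlgebra K (Trop m)) F]
    (t : SeedData n (Trop m) F) (k : Fin n) : Subalgebra (coeffPolyRing K m) F :=
  Algebra.adjoin (coeffPolyRing K m) (t.A '' {j | j ≠ k})

end Geometric

end SeedData

/-- The valuation pairing `(a || M)_v = max {s ∈ ℕ | M / a ^ s ∈ U}`, which is `∞` if there are
arbitrarily large such `s`. -/
noncomputable def valuationPairing {R F : Type*} [CommRing R] [Field F] [Algebra R F]
    (U : Subalgebra R F) (a : F) (M : U) : ℕ∞ :=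
  sSup ((fun s : ℕ => (s : ℕ∞)) '' {s : ℕ | (M : F) / a ^ s ∈ U})

end ClusterAlgebra

/-! The generators of the tropical semifield are treated as further, never mutated variables, so
each ring `ℒ(t)` becomes a Laurent polynomial ring over `K` in the family `coords`, and an exchange
binomial becomes `bin` of a column of the extended matrix. Such a ring is a localization of a
polynomial ring over a factorial domain, hence factorial.

The first pillar is that full rank makes `𝒰` equal to its upper bound, the intersection of the
Laurent rings of the initial seed and its `n` neighbours (`mem_upperClusterAlgebra_iff`). Full rank
survives mutation, so it suffices that the upper bound does not change under one mutation. This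
reduces to two directions `i ≠ k`: an element of the Laurent rings of `μ_k t` and `μ_i t` lies in
that of `μ_i μ_k t` (`mem_laurent_mutVar_mutVar`), because its two possible denominators there are
coprime. Coprimality is tested by gradings: a divisor of a homogeneous element is homogeneous
(`sep_binomial`).

The second pillar is local. `A_k` is a unit in the Laurent rings of the seed and of all its
neighbours except `μ_k t`, where `A_k = P_k / A'_k` is associated to `P_k`. Thus divisibility by
`A_k` in `𝒰` is divisibility by `P_k` in that one factorial ring. It follows that irreducibility of
`P_k` gives primality of `A_k`. Conversely, if `A_k` is prime, a factorization `P_k = f g = A_k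
A'_k` has one factor divisible by `A_k`; the other is then a Laurent monomial dividing a binomial
which no variable divides, hence a constant unit.

Finally, `A_k` is always irreducible (`irreducible_A`), hence prime if `𝒰` is factorial. If all
`A_k` are prime, inverting them yields the factorial ring `ℒ(t₀)`, and Nagata's criterion applies.
The valuation pairing is the multiplicity of `A_k`, whose additivity on nonzero elements is
primality of the non-unit `A_k`. -/

open Polynomial LaurentPolynomial in
/-- A divisor of a nonzero monomial in a Laurent polynomial ring over a domain is a monomial. -/
theorem LaurentPolynomial.exists_eq_C_mul_T_of_dvd {D : Type*} [CommRing D] [IsDomain D]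
    {q : D[T;T⁻¹]} {a : D} (ha : a ≠ 0) {n : ℤ} (h : q ∣ C a * T n) :
    ∃ c e, q = C c * T e := by
  obtain ⟨r, hr⟩ := h
  obtain ⟨N, q', hq⟩ := exists_T_pow q
  obtain ⟨M, r', hr'⟩ := exists_T_pow r
  obtain ⟨k, l, hkl⟩ : ∃ k l : ℕ, n + N + M = (k : ℤ) - l :=
    ⟨(n + N + M).toNat, (-(n + N + M)).toNat, by omega⟩
  have key : q' * r' * Polynomial.X ^ l = Polynomial.C a * Polynomial.X ^ k := by
    apply Polynomial.toLaurent_injective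
    rw [map_mul, map_mul, map_mul, hq, hr', Polynomial.toLaurent_X_pow,
      Polynomial.toLaurent_X_pow, Polynomial.toLaurent_C]
    calc q * T N * (r * T M) * T l = (q * r) * (T N * T M * T l) := by ring
      _ = C a * (T n * (T N * T M * T l)) := by rw [← hr]; ring
      _ = C a * T k := by
        rw [← T_add, ← T_add, ← T_add]
        congr 2
        omega
  have hne : q' * r' * Polynomial.X ^ l ≠ 0 := by
    rw [key]
    exact mul_ne_zero (by simpa using ha) (pow_ne_zero _ Polynomial.X_ne_zero)
  have hX : (Polynomial.X ^ l : D[X]) ≠ 0 := pow_ne_zero _ Polynomial.X_ne_zero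
  have hq0 : q' ≠ 0 := fun h0 => hne (by simp [h0])
  have hr0 : r' ≠ 0 := fun h0 => hne (by simp [h0])
  -- Over a domain, degree and trailing degree are both additive. They agree on the monomial, so
  -- they must agree on each factor.
  have h1 := congrArg Polynomial.natDegree key
  have h2 := congrArg Polynomial.natTrailingDegree key
  rw [Polynomial.natDegree_mul (mul_ne_zero hq0 hr0) hX, Polynomial.natDegree_mul hq0 hr0,
    Polynomial.natDegree_X_pow, Polynomial.natDegree_C_mul_X_pow _ _ ha] at h1
  rw [Polynomial.natTrailingDegree_mul (mul_ne_zero hq0 hr0) hX,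
    Polynomial.natTrailingDegree_mul hq0 hr0, Polynomial.natTrailingDegree_X_pow,
    Polynomial.C_mul_X_pow_eq_monomial, Polynomial.natTrailingDegree_monomial ha] at h2
  have h3 := Polynomial.natTrailingDegree_le_natDegree q'
  have h4 := Polynomial.natTrailingDegree_le_natDegree r'
  have h5 : q' = Polynomial.C (q'.coeff q'.natDegree) * Polynomial.X ^ q'.natDegree := by
    ext j
    rw [Polynomial.coeff_C_mul_X_pow]
    split_ifs with hj
    · rw [hj]
    · rcases lt_or_gt_of_ne hj with hj | hj
      · exact Polynomial.coeff_eq_zero_of_lt_natTrailingDegree (by omega)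
      · exact Polynomial.coeff_eq_zero_of_natDegree_lt hj
  refine ⟨q'.coeff q'.natDegree, q'.natDegree - N, ?_⟩
  have h6 := congrArg Polynomial.toLaurent h5
  rw [map_mul, Polynomial.toLaurent_C, Polynomial.toLaurent_X_pow, hq] at h6
  calc q = q * T N * T (-N) := by rw [mul_T_assoc]; simp
    _ = _ := by rw [h6, mul_T_assoc, sub_eq_add_neg]

/-! ### Laurent polynomial subrings of a field. -/

namespace ClusterAlgebra

/-- The Laurent monomial `∏ y_l ^ v_l`. -/
noncomputable def mon {σ F : Type*} [Fintype σ] [Field F] (y : σ → F) (v : σ → ℤ) : F :=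
  ∏ l, y l ^ v l

/-- The subring of Laurent polynomials in the family `y`. -/
noncomputable def laurent (K : Type*) {σ F : Type*} [CommRing K] [Field F] [Algebra K F]
    (y : σ → F) : Subalgebra K F :=
  Algebra.adjoin K (Set.range y ∪ Set.range fun i => (y i)⁻¹)

section Basic

variable {K σ F : Type*} [CommRing K] [Field F] [Algebra K F] {y : σ → F}

theorem mem_laurent (i : σ) : y i ∈ laurent K y :=
  Algebra.subset_adjoin (Or.inl ⟨i, rfl⟩)

theorem inv_mem_laurent (i : σ) : (y i)⁻¹ ∈ laurent K y :=
  Algebra.subset_adjoin (Or.inr ⟨i, rfl⟩)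

theorem zpow_mem_of_inv_mem {L : Subalgebra K F} {a : F} (h : a ∈ L) (h' : a⁻¹ ∈ L) (n : ℤ) :
    a ^ n ∈ L := by
  obtain ⟨k, rfl | rfl⟩ := n.eq_nat_or_neg
  · simpa using pow_mem h k
  · simpa using pow_mem h' k

theorem adjoin_le_laurent : Algebra.adjoin K (Set.range y) ≤ laurent K y :=
  Algebra.adjoin_mono Set.subset_union_left

/-- If some power of `s` times each generator lies in `L`, the same holds on the whole algebra. -/
theorem exists_pow_mul_mem_of_mem_adjoin {L : Subalgebra K F} {s : F} (hs : s ∈ L) {S : Set F}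
    (hS : ∀ x ∈ S, ∃ N : ℕ, s ^ N * x ∈ L) {f : F} (hf : f ∈ Algebra.adjoin K S) :
    ∃ N : ℕ, s ^ N * f ∈ L := by
  induction hf using Algebra.adjoin_induction with
  | mem x hx => exact hS x hx
  | algebraMap r => exact ⟨0, by simp [L.algebraMap_mem r]⟩
  | add a b _ _ iha ihb =>
    obtain ⟨N, hN⟩ := iha
    obtain ⟨M, hM⟩ := ihb
    refine ⟨N + M, ?_⟩
    have : s ^ (N + M) * (a + b) = s ^ M * (s ^ N * a) + s ^ N * (s ^ M * b) := by ring
    rw [this]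
    exact add_mem (mul_mem (pow_mem hs _) hN) (mul_mem (pow_mem hs _) hM)
  | mul a b _ _ iha ihb =>
    obtain ⟨N, hN⟩ := iha
    obtain ⟨M, hM⟩ := ihb
    refine ⟨N + M, ?_⟩
    have : s ^ (N + M) * (a * b) = (s ^ N * a) * (s ^ M * b) := by ring
    rw [this]
    exact mul_mem hN hM

variable [Fintype σ]

theorem mon_mem (v : σ → ℤ) : mon y v ∈ laurent K y :=
  prod_mem fun i _ => zpow_mem_of_inv_mem (mem_laurent i) (inv_mem_laurent i) _

theorem mon_zero : mon y 0 = 1 := by simp [mon]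

theorem mon_neg (v : σ → ℤ) : mon y (-v) = (mon y v)⁻¹ := by simp [mon]

theorem mon_ne_zero (hy : ∀ i, y i ≠ 0) (v : σ → ℤ) : mon y v ≠ 0 :=
  Finset.prod_ne_zero_iff.2 fun i _ => zpow_ne_zero _ (hy i)

theorem mon_add (hy : ∀ i, y i ≠ 0) (v w : σ → ℤ) : mon y (v + w) = mon y v * mon y w := by
  simp [mon, zpow_add₀ (hy _), Finset.prod_mul_distrib]

theorem mon_smul (n : ℕ) (v : σ → ℤ) : mon y (n • v) = mon y v ^ n := by
  rw [mon, mon, ← Finset.prod_pow]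
  refine Finset.prod_congr rfl fun l _ => ?_
  rw [← zpow_natCast, ← zpow_mul, mul_comm]
  simp

theorem mon_single [DecidableEq σ] (i : σ) (n : ℤ) : mon y (Pi.single i n) = y i ^ n := by
  rw [mon, Finset.prod_eq_single i] <;> simp +contextual

theorem mon_update [DecidableEq σ] {k : σ} {v : σ → ℤ} (hv : v k = 0) (a : F) :
    mon (Function.update y k a) v = mon y v := by
  refine Finset.prod_congr rfl fun l _ => ?_
  rcases eq_or_ne l k with rfl | h
  · simp [hv]
  · rw [Function.update_of_ne h]

end Basic

section Localization

variable {K σ F : Type*} [CommRing K] [Field F] [Algebra K F] {y : σ → F}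

variable (K y) in
/-- Evaluation of polynomials in the Laurent ring. -/
noncomputable def polyToLaurent : MvPolynomial σ K →ₐ[K] laurent K y :=
  MvPolynomial.aeval fun i => ⟨y i, mem_laurent i⟩

theorem coe_polyToLaurent (p : MvPolynomial σ K) :
    (polyToLaurent K y p : F) = MvPolynomial.aeval y p := by
  change (laurent K y).val (polyToLaurent K y p) = _
  rw [polyToLaurent, ← AlgHom.comp_apply, MvPolynomial.comp_aeval]
  rfl

noncomputable instance : Algebra (MvPolynomial σ K) (laurent K y) :=
  (polyToLaurent K y).toRingHom.toAlgebra

theorem algebraMap_laurent_apply (p : MvPolynomial σ K) :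
    algebraMap (MvPolynomial σ K) (laurent K y) p = polyToLaurent K y p := rfl

instance : IsScalarTower K (MvPolynomial σ K) (laurent K y) :=
  .of_algebraMap_eq fun x => by simp [algebraMap_laurent_apply]

variable [Fintype σ]

theorem exists_pow_mul_eq_aeval (hy : ∀ i, y i ≠ 0) {f : F} (hf : f ∈ laurent K y) :
    ∃ (N : ℕ) (p : MvPolynomial σ K), (∏ i, y i) ^ N * f = MvPolynomial.aeval y p := by
  classical
  have hs : ∏ i, y i ∈ Algebra.adjoin K (Set.range y) :=
    prod_mem fun i _ => Algebra.subset_adjoin ⟨i, rfl⟩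
  obtain ⟨N, hN⟩ := exists_pow_mul_mem_of_mem_adjoin hs
    (S := Set.range y ∪ Set.range fun i => (y i)⁻¹) (by
    rintro x (⟨i, rfl⟩ | ⟨i, rfl⟩)
    · exact ⟨0, by simpa using Algebra.subset_adjoin (s := Set.range y) ⟨i, rfl⟩⟩
    · refine ⟨1, ?_⟩
      simp only [pow_one]
      rw [← Finset.mul_prod_erase _ _ (Finset.mem_univ i), mul_comm, inv_mul_cancel_left₀ (hy i)]
      exact prod_mem fun i _ => Algebra.subset_adjoin ⟨i, rfl⟩) hf
  rw [Algebra.adjoin_range_eq_range_aeval] at hN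
  obtain ⟨p, hp⟩ := hN
  exact ⟨N, p, hp.symm⟩

/-- Clearing denominators gives surjectivity, algebraic independence gives injectivity. This is the
source of factoriality and of homomorphisms out of the Laurent ring. -/
theorem isLocalization_laurent [Nontrivial K] (hy : AlgebraicIndependent K y) :
    IsLocalization.Away (∏ i, MvPolynomial.X i : MvPolynomial σ K) (laurent K y) := by
  have hy0 : ∀ i, y i ≠ 0 := fun i => hy.ne_zero i
  refine (isLocalization_iff _ _).2 ⟨?_, ?_, ?_⟩
  · rintro ⟨_, N, rfl⟩
    simp only [map_pow, map_prod]
    refine IsUnit.pow _ ((Finset.prod_induction _ IsUnit (fun _ _ => IsUnit.mul) isUnit_one ?_))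
    intro i _
    refine IsUnit.of_mul_eq_one ⟨(y i)⁻¹, inv_mem_laurent i⟩ (Subtype.ext ?_)
    simp [algebraMap_laurent_apply, coe_polyToLaurent, hy0 i]
  · rintro ⟨f, hf⟩
    obtain ⟨N, p, h⟩ := exists_pow_mul_eq_aeval hy0 hf
    refine ⟨⟨p, ⟨_, N, rfl⟩⟩, Subtype.ext ?_⟩
    simp [algebraMap_laurent_apply, coe_polyToLaurent, ← h, mul_comm]
  · intro a b h
    refine ⟨1, ?_⟩
    have := congrArg (Subtype.val) h
    simp only [algebraMap_laurent_apply, coe_polyToLaurent] at this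
    rw [hy this]

theorem uniqueFactorizationMonoid_laurent [IsDomain K] [UniqueFactorizationMonoid K]
    (hy : AlgebraicIndependent K y) : UniqueFactorizationMonoid (laurent K y) :=
  have := isLocalization_laurent hy
  .of_isLocalization (Submonoid.powers (∏ i, MvPolynomial.X i : MvPolynomial σ K)) _

open MvPolynomial in
theorem prod_X_pow_eq_monomial (N : ℕ) :
    (∏ i, X i : MvPolynomial σ K) ^ N = monomial (Finsupp.equivFunOnFinite.symm fun _ => N) 1 := by
  rw [monomial_eq, Finsupp.prod_fintype _ _ (by simp)]
  simp [Finset.prod_pow]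

/-- A polynomial dividing a monomial in the Laurent ring is itself a unit times a monomial. -/
theorem exists_eq_monomial_of_mul_eq_one [IsDomain K] (hy : AlgebraicIndependent K y)
    {p : MvPolynomial σ K} {g : F} (hg : g ∈ laurent K y) (h : MvPolynomial.aeval y p * g = 1) :
    ∃ e u, IsUnit u ∧ p = MvPolynomial.monomial e u := by
  obtain ⟨N, q, hq⟩ := exists_pow_mul_eq_aeval (fun i => hy.ne_zero i) hg
  have : p * q = MvPolynomial.monomial (Finsupp.equivFunOnFinite.symm fun _ => N) 1 := by
    apply hy
    rw [← prod_X_pow_eq_monomial, map_mul, ← hq]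
    simp only [map_pow, map_prod, MvPolynomial.aeval_X]
    linear_combination (∏ i, y i) ^ N * h
  obtain ⟨e, u, _, hu, rfl⟩ := MvPolynomial.dvd_monomial_one_iff_exists.1 ⟨q, this.symm⟩
  exact ⟨e, u, hu, rfl⟩

/-- Units of a Laurent polynomial ring over a domain are units of the base times monomials. -/
theorem exists_eq_mon_of_inv_mem [IsDomain K] (hy : AlgebraicIndependent K y) {f : F}
    (hf0 : f ≠ 0) (hf : f ∈ laurent K y) (hf' : f⁻¹ ∈ laurent K y) :
    ∃ (u : K) (e : σ → ℤ), IsUnit u ∧ f = algebraMap K F u * mon y e := by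
  have hy0 : ∀ i, y i ≠ 0 := fun i => hy.ne_zero i
  obtain ⟨N, p, hp⟩ := exists_pow_mul_eq_aeval hy0 hf
  have hs : (∏ i, y i) ^ N ≠ 0 := pow_ne_zero _ (Finset.prod_ne_zero_iff.2 fun i _ => hy0 i)
  have hm : ((∏ i, y i) ^ N)⁻¹ = mon y (fun _ => -(N : ℤ)) := by
    simp [mon, Finset.prod_inv_distrib, Finset.prod_pow]
  obtain ⟨e, u, hu, rfl⟩ := exists_eq_monomial_of_mul_eq_one hy
    (p := p) (g := f⁻¹ * mon y (fun _ => -(N : ℤ)))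
    (mul_mem hf' (mon_mem _)) (by rw [← hp, ← hm]; field_simp)
  refine ⟨u, (fun i => (e i : ℤ)) + (fun _ => -(N : ℤ)), hu, ?_⟩
  rw [mon_add hy0, ← hm, ← mul_assoc, eq_mul_inv_iff_mul_eq₀ hs, mul_comm, hp,
    MvPolynomial.aeval_monomial, Finsupp.prod_fintype _ _ (by simp)]
  simp [mon]

end Localization

section Grading

open LaurentPolynomial

variable {K σ F : Type*} [CommRing K] [Field F] [Algebra K F] {y : σ → F} [Fintype σ]

/-- The grading of the Laurent ring by integer weights `φ`, as a homomorphism scaling `y_i` by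
`T ^ φ_i`. -/
theorem exists_gradingHom [Nontrivial K] (hy : AlgebraicIndependent K y) (φ : σ → ℤ) :
    ∃ τ : laurent K y →ₐ[K] (laurent K y)[T;T⁻¹],
      (∀ i, τ ⟨y i, mem_laurent i⟩ = C ⟨y i, mem_laurent i⟩ * T (φ i)) ∧
      ∀ a c e, τ a = C c * T e → c = a := by
  have hy0 : ∀ i, y i ≠ 0 := fun i => hy.ne_zero i
  have := isLocalization_laurent hy
  let f : MvPolynomial σ K →ₐ[K] (laurent K y)[T;T⁻¹] :=
    MvPolynomial.aeval fun i => C ⟨y i, mem_laurent i⟩ * T (φ i)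
  have hf : IsUnit (f (∏ i, MvPolynomial.X i)) := by
    rw [map_prod]
    refine Finset.prod_induction _ IsUnit (fun _ _ => IsUnit.mul) isUnit_one fun i _ => ?_
    simp only [f, MvPolynomial.aeval_X]
    refine IsUnit.mul (IsUnit.map _ ?_) (isUnit_T _)
    exact IsUnit.of_mul_eq_one ⟨(y i)⁻¹, inv_mem_laurent i⟩ (Subtype.ext (by simp [hy0 i]))
  let τ : laurent K y →ₐ[K] (laurent K y)[T;T⁻¹] := IsLocalization.Away.liftAlgHom _ hf
  have hτ : ∀ i, τ ⟨y i, mem_laurent i⟩ = C ⟨y i, mem_laurent i⟩ * T (φ i) := by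
    intro i
    have h1 : (⟨y i, mem_laurent i⟩ : laurent K y) =
        algebraMap (MvPolynomial σ K) (laurent K y) (MvPolynomial.X i) :=
      Subtype.ext (by simp [algebraMap_laurent_apply, coe_polyToLaurent])
    have h2 : τ (algebraMap (MvPolynomial σ K) (laurent K y) (MvPolynomial.X i)) =
        f (MvPolynomial.X i) := IsLocalization.Away.lift_eq _ hf _
    conv_lhs => rw [h1]
    rw [h2, MvPolynomial.aeval_X]
  refine ⟨τ, hτ, fun a c e h => ?_⟩
  -- Specializing `T` to `1` is a left inverse of `τ`, so a homogeneous element is its own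
  -- coefficient.
  let ev : (laurent K y)[T;T⁻¹] →+* laurent K y := LaurentPolynomial.eval₂ (RingHom.id _) 1
  have hev : ev.comp (τ : laurent K y →+* (laurent K y)[T;T⁻¹]) = RingHom.id _ := by
    refine IsLocalization.ringHom_ext
      (Submonoid.powers (∏ i, MvPolynomial.X i : MvPolynomial σ K)) ?_
    refine MvPolynomial.ringHom_ext (fun r => ?_) fun i => ?_
    · have : algebraMap (MvPolynomial σ K) (laurent K y) (MvPolynomial.C r) =
          algebraMap K _ r := by simp [algebraMap_laurent_apply]
      simp only [RingHom.comp_apply, this, RingHom.coe_coe, AlgHom.commutes]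
      simp [ev, LaurentPolynomial.algebraMap_apply]
    · have : algebraMap (MvPolynomial σ K) (laurent K y) (MvPolynomial.X i) =
          ⟨y i, mem_laurent i⟩ :=
        Subtype.ext (by simp [algebraMap_laurent_apply, coe_polyToLaurent])
      simp only [RingHom.comp_apply, this, RingHom.coe_coe, hτ]
      simp [ev]
  have := congrArg ev h
  rw [show ev (τ a) = a from RingHom.congr_fun hev a] at this
  rw [this]
  simp [ev]

end Grading

end ClusterAlgebra

/-! ### Coprime denominators and gradings. -/

namespace ClusterAlgebra

section Separation

variable {K F : Type*} [CommRing K] [Field F] [Algebra K F]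

/-- `a` and `b` form a pair of coprime denominators over `L`: an element of the field all of whose
denominators divide both `a` and `b` belongs to `L`. -/
def Sep (L : Subalgebra K F) (a b : F) : Prop :=
  ∀ f : F, a * f ∈ L → b * f ∈ L → f ∈ L

variable {L : Subalgebra K F} {a b c u : F}

theorem Sep.symm (h : Sep L a b) : Sep L b a := fun f h1 h2 => h f h2 h1

theorem sep_one : Sep L a 1 := fun f _ h => by simpa using h

theorem Sep.mul (h : Sep L a b) (h' : Sep L a c) (hc : c ∈ L) : Sep L a (b * c) := by
  intro f h1 h2
  refine h' f h1 (h _ ?_ (by rwa [← mul_assoc]))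
  rw [mul_left_comm]
  exact mul_mem hc h1

theorem Sep.pow (h : Sep L a b) (hb : b ∈ L) (N : ℕ) : Sep L a (b ^ N) := by
  induction N with
  | zero => simpa using sep_one
  | succ N ih => rw [pow_succ]; exact ih.mul h hb

theorem Sep.pow_pow (h : Sep L a b) (ha : a ∈ L) (hb : b ∈ L) (N M : ℕ) :
    Sep L (a ^ N) (b ^ M) :=
  ((h.pow hb M).symm.pow ha N).symm

/-- Only the class of the second denominator modulo the first matters, up to a multiple. Combined
with `sep_one`, this is the comaximal case. -/
theorem Sep.of_eq (h : Sep L a b) (hu : u ∈ L) (hc : c ∈ L) {b' : F}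
    (hb : b = u * b' + c * a) : Sep L a b' := by
  intro f h1 h2
  refine h f h1 ?_
  rw [hb, add_mul, mul_assoc, mul_assoc]
  exact add_mem (mul_mem hu h2) (mul_mem hc h1)

end Separation

section Grading

open LaurentPolynomial

variable {K σ F : Type*} [CommRing K] [Field F] [Algebra K F] {y : σ → F} [Fintype σ]

theorem gradingHom_inv {L : Subalgebra K F} {τ : L →ₐ[K] L[T;T⁻¹]} {a b : L} {e : ℤ}
    (ha : τ a = C a * T e) (hab : a * b = 1) : τ b = C b * T (-e) := by
  have h1 : τ a * τ b = 1 := by rw [← map_mul, hab, map_one]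
  have h2 : (C a * C b : L[T;T⁻¹]) = 1 := by rw [← map_mul, hab, map_one]
  have h3 : (T e * T (-e) : L[T;T⁻¹]) = 1 := by rw [← T_add]; simp
  rw [ha] at h1
  linear_combination (C b * T (-e)) * h1 - τ b * T e * T (-e) * h2 - τ b * h3

theorem gradingHom_mon {φ : σ → ℤ} (hy : ∀ i, y i ≠ 0)
    {τ : laurent K y →ₐ[K] (laurent K y)[T;T⁻¹]}
    (hτ : ∀ i, τ ⟨y i, mem_laurent i⟩ = C ⟨y i, mem_laurent i⟩ * T (φ i)) (v : σ → ℤ) :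
    τ ⟨mon y v, mon_mem v⟩ = C ⟨mon y v, mon_mem v⟩ * T (∑ i, φ i * v i) := by
  classical
  have hn (i : σ) (n : ℕ) : τ ⟨y i ^ n, pow_mem (mem_laurent i) n⟩ =
      C ⟨y i ^ n, pow_mem (mem_laurent i) n⟩ * T (φ i * n) := by
    have : (⟨y i ^ n, pow_mem (mem_laurent i) n⟩ : laurent K y) = ⟨y i, mem_laurent i⟩ ^ n := rfl
    rw [this, map_pow, hτ, mul_pow, T_pow, map_pow, mul_comm (φ i)]
  have hz (i : σ) (n : ℤ) :
      τ ⟨y i ^ n, zpow_mem_of_inv_mem (mem_laurent i) (inv_mem_laurent i) n⟩ =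
      C ⟨y i ^ n, zpow_mem_of_inv_mem (mem_laurent i) (inv_mem_laurent i) n⟩ * T (φ i * n) := by
    obtain ⟨k, rfl | rfl⟩ := n.eq_nat_or_neg
    · simpa using hn i k
    · rw [mul_neg]
      exact gradingHom_inv (hn i k) (Subtype.ext (by simp [hy i]))
  have hs (s : Finset σ) :
      τ ⟨∏ i ∈ s, y i ^ v i,
        prod_mem fun i _ => zpow_mem_of_inv_mem (mem_laurent i) (inv_mem_laurent i) _⟩ =
      C ⟨∏ i ∈ s, y i ^ v i,
        prod_mem fun i _ => zpow_mem_of_inv_mem (mem_laurent i) (inv_mem_laurent i) _⟩ *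
      T (∑ i ∈ s, φ i * v i) := by
    induction s using Finset.induction_on with
    | empty =>
      simp only [Finset.prod_empty, Finset.sum_empty, T_zero, mul_one]
      exact (map_one τ).trans (map_one C).symm
    | insert i s hi ih =>
      simp only [Finset.prod_insert hi, Finset.sum_insert hi, T_add]
      rw [← MulMemClass.mk_mul_mk (laurent K y) _ _
        (zpow_mem_of_inv_mem (mem_laurent i) (inv_mem_laurent i) _)
        (prod_mem fun i _ => zpow_mem_of_inv_mem (mem_laurent i) (inv_mem_laurent i) _),
        map_mul, map_mul, ih, hz]
      ring
  exact hs Finset.univ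

theorem isUnit_mk_mon (hy : ∀ i, y i ≠ 0) (v : σ → ℤ) :
    IsUnit (⟨mon y v, mon_mem v⟩ : laurent K y) :=
  IsUnit.of_mul_eq_one ⟨mon y (-v), mon_mem _⟩
    (Subtype.ext (by simp [mon_neg, mon_ne_zero hy v]))

/-- A two-term Laurent polynomial whose terms have distinct weights is not homogeneous. -/
theorem not_homogeneous_of_ne [Nontrivial K] (hy : AlgebraicIndependent K y) {φ a b : σ → ℤ}
    (hab : ∑ i, φ i * a i ≠ ∑ i, φ i * b i)
    {τ : laurent K y →ₐ[K] (laurent K y)[T;T⁻¹]}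
    (hτ : ∀ i, τ ⟨y i, mem_laurent i⟩ = C ⟨y i, mem_laurent i⟩ * T (φ i))
    (c : laurent K y) (e : ℤ) :
    τ (⟨mon y a, mon_mem a⟩ + ⟨mon y b, mon_mem b⟩) ≠ C c * T e := by
  have hy0 : ∀ i, y i ≠ 0 := fun i => hy.ne_zero i
  intro h
  rw [map_add, gradingHom_mon hy0 hτ, gradingHom_mon hy0 hτ, ← single_eq_C_mul_T,
    ← single_eq_C_mul_T, ← single_eq_C_mul_T] at h
  have h1 := congrArg (fun q => q.coeff (∑ i, φ i * a i)) h
  have h2 := congrArg (fun q => q.coeff (∑ i, φ i * b i)) h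
  simp only [AddMonoidAlgebra.coeff_add, AddMonoidAlgebra.coeff_single, Finsupp.add_apply,
    Finsupp.single_apply, hab, hab.symm, if_true, if_false, add_zero, zero_add] at h1 h2
  have ha : (⟨mon y a, mon_mem a⟩ : laurent K y) ≠ 0 := (isUnit_mk_mon hy0 a).ne_zero
  have hb : (⟨mon y b, mon_mem b⟩ : laurent K y) ≠ 0 := (isUnit_mk_mon hy0 b).ne_zero
  split_ifs at h1 h2 with h3 h4
  · exact hab (h3.symm.trans h4)
  · exact hb h2
  · exact ha h1
  · exact ha h1

/-- Grade by a coordinate in which the exponents differ: zero is homogeneous, the binomial is not.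
-/
theorem mon_add_mon_ne_zero [Nontrivial K] (hy : AlgebraicIndependent K y) {a b : σ → ℤ}
    (hab : a ≠ b) : mon y a + mon y b ≠ 0 := by
  classical
  obtain ⟨l, hl⟩ := Function.ne_iff.1 hab
  obtain ⟨τ, hτ, -⟩ := exists_gradingHom hy (Pi.single l 1)
  intro h
  refine not_homogeneous_of_ne hy (a := a) (b := b) (by simpa [Pi.single_apply] using hl) hτ 0 0 ?_
  rw [show (⟨mon y a, mon_mem a⟩ + ⟨mon y b, mon_mem b⟩ : laurent K y) = 0 from Subtype.ext h]
  simp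

/-- The grading homomorphism sends a unit to a divisor of `1`, which is a monomial in `T`; the
binomial is not homogeneous for a suitable grading. -/
theorem inv_mon_add_mon_not_mem [IsDomain K] (hy : AlgebraicIndependent K y) {a b : σ → ℤ}
    (hab : a ≠ b) : (mon y a + mon y b)⁻¹ ∉ laurent K y := by
  classical
  obtain ⟨l, hl⟩ := Function.ne_iff.1 hab
  obtain ⟨τ, hτ, -⟩ := exists_gradingHom hy (Pi.single l 1)
  intro h
  have h1 : (⟨mon y a, mon_mem a⟩ + ⟨mon y b, mon_mem b⟩ : laurent K y) * ⟨_, h⟩ = 1 :=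
    Subtype.ext (mul_inv_cancel₀ (mon_add_mon_ne_zero hy hab))
  obtain ⟨c, e, hc⟩ := LaurentPolynomial.exists_eq_C_mul_T_of_dvd
    (one_ne_zero (α := laurent K y)) (n := 0) (q := τ (⟨mon y a, mon_mem a⟩ + ⟨mon y b, mon_mem b⟩))
    ⟨τ ⟨_, h⟩, by rw [← map_mul, h1]; simp⟩
  exact not_homogeneous_of_ne hy (a := a) (b := b)
    (by simpa [Pi.single_apply] using hl) hτ c e hc

/-- A binomial of weight zero is coprime to a two-term Laurent polynomial with terms of distinct
weights, one of them with coefficient one. -/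
theorem sep_binomial [IsDomain K] [UniqueFactorizationMonoid K] (hy : AlgebraicIndependent K y)
    {φ w a b : σ → ℤ} (hw : w ≠ 0) (hφw : ∑ i, φ i * w i = 0)
    (hab : ∑ i, φ i * a i ≠ ∑ i, φ i * b i) (κ : K) :
    Sep (laurent K y) (1 + mon y w) (mon y a + algebraMap K F κ * mon y b) := by
  have hy0 : ∀ i, y i ≠ 0 := fun i => hy.ne_zero i
  have := uniqueFactorizationMonoid_laurent hy
  obtain ⟨τ, hτ, hτ1⟩ := exists_gradingHom hy φ
  set p : laurent K y := 1 + ⟨mon y w, mon_mem w⟩ with hp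
  set g : laurent K y := ⟨mon y a, mon_mem a⟩ + algebraMap K _ κ * ⟨mon y b, mon_mem b⟩ with hg
  have hp0 : p ≠ 0 := by
    intro h
    refine mon_add_mon_ne_zero hy hw.symm ?_
    simpa [hp, mon_zero] using congrArg Subtype.val h
  have hτp : τ p = C p * T 0 := by
    simp [hp, gradingHom_mon hy0 hτ, hφw]
  have hrel : IsRelPrime p g := by
    -- A common divisor `q` divides an element of weight zero, hence is homogeneous. Comparing
    -- coefficients of `g = q * r` at the weight of `a` shows that `q` divides the unit `mon y a`.
    rintro q hqp ⟨r, hr⟩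
    obtain ⟨c, e, hc⟩ := LaurentPolynomial.exists_eq_C_mul_T_of_dvd hp0
      (hτp ▸ map_dvd τ hqp : τ q ∣ C p * T 0)
    obtain rfl := hτ1 _ _ _ hc
    have h1 := congrArg τ hr
    rw [map_mul, hc, hg, map_add, map_mul, AlgHom.commutes, gradingHom_mon hy0 hτ,
      gradingHom_mon hy0 hτ, LaurentPolynomial.algebraMap_apply, ← mul_assoc, ← map_mul,
      ← single_eq_C_mul_T, ← single_eq_C_mul_T, ← single_eq_C_mul_T] at h1
    have h2 := congrArg (fun q => q.coeff (∑ i, φ i * a i)) h1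
    simp only [AddMonoidAlgebra.coeff_single_mul_apply, AddMonoidAlgebra.coeff_add,
      AddMonoidAlgebra.coeff_single, Finsupp.add_apply, Finsupp.single_apply, hab.symm, if_true,
      if_false, add_zero] at h2
    exact isUnit_of_dvd_unit ⟨_, h2⟩ (isUnit_mk_mon hy0 a)
  intro f h1 h2
  -- `p` divides `g * (p * f) = p * (g * f)` and is coprime to `g`.
  have h3 : p ∣ ⟨_, h1⟩ := by
    refine hrel.dvd_of_dvd_mul_right (z := g) ⟨⟨_, h2⟩, Subtype.ext ?_⟩
    simp [hp, hg]
    ring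
  obtain ⟨r, hr⟩ := h3
  have h4 : (p : F) * f = p * r := by simpa [hp] using congrArg Subtype.val hr
  rw [mul_left_cancel₀ (by simpa using hp0) h4]
  exact r.2

end Grading
end ClusterAlgebra

/-! ### Mutation of variables and the two-direction case of the upper bound. -/

namespace ClusterAlgebra

section Auxiliary

variable {K σ F : Type*} [CommRing K] [Field F] [Algebra K F]

/-- Clearing denominators between the Laurent rings of two clusters. -/
theorem exists_pow_mul_mem {L : Subalgebra K F} {y' : σ → F} {s : F} (hs : s ∈ L)
    (h1 : ∀ l, y' l ∈ L) (h2 : ∀ l, (y' l)⁻¹ ∈ L ∨ s * (y' l)⁻¹ ∈ L) {f : F}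
    (hf : f ∈ laurent K y') : ∃ N : ℕ, s ^ N * f ∈ L := by
  refine exists_pow_mul_mem_of_mem_adjoin hs ?_ hf
  rintro x (⟨l, rfl⟩ | ⟨l, rfl⟩)
  · exact ⟨0, by simpa using h1 l⟩
  · rcases h2 l with h | h
    · exact ⟨0, by simpa using h⟩
    · exact ⟨1, by simpa using h⟩

/-- The linear term must be explicit: it is what survives modulo the denominator in
`mem_laurent_mutVar_mutVar_of_pos`. -/
theorem exists_one_add_pow_eq {L : Subalgebra K F} {ζ : F} (hζ : ζ ∈ L) (n : ℕ) :
    ∃ G ∈ L, (1 + ζ) ^ n = 1 + n * ζ + ζ * ζ * G := by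
  induction n with
  | zero => exact ⟨0, zero_mem _, by simp⟩
  | succ n ih =>
    obtain ⟨G, hG, h⟩ := ih
    refine ⟨G + n + ζ * G, add_mem (add_mem hG (natCast_mem _ n)) (mul_mem hζ hG), ?_⟩
    rw [pow_succ, h]
    push_cast
    ring

/-- Mutation at `k`, with `k`-th column `v`, of another column `w`. -/
def mutCol [DecidableEq σ] (k : σ) (v w : σ → ℤ) : σ → ℤ :=
  fun l => if l = k then -w l else w l + (v l).sign * max (v l * w k) 0

theorem mutCol_neg [DecidableEq σ] (k : σ) (v w : σ → ℤ) : mutCol k (-v) (-w) = -mutCol k v w := by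
  ext l
  simp only [mutCol, Pi.neg_apply, Int.sign_neg, neg_mul_neg]
  split_ifs <;> ring

/-- Two integer vectors without integer relation are separated by a linear functional. -/
theorem exists_weight [Fintype σ] [DecidableEq σ] {v w : σ → ℤ}
    (h : ∀ a b : ℤ, a • v + b • w = 0 → a = 0 ∧ b = 0) :
    ∃ φ : σ → ℤ, ∑ l, φ l * w l = 0 ∧ ∑ l, φ l * v l ≠ 0 := by
  by_contra! hc
  -- The functional `w a • e_b - w b • e_a` kills `w`, hence `v`. So all `2 × 2` minors vanish,
  -- which yields the relation `w a • v - v a • w = 0`.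
  have h1 (a b : σ) : w a * v b = w b * v a := by
    have := hc (Pi.single b (w a) - Pi.single a (w b))
      (by simp [sub_mul, Finset.sum_sub_distrib, Pi.single_apply]; ring)
    simp [sub_mul, Finset.sum_sub_distrib, Pi.single_apply] at this
    linarith
  have hw : w = 0 := by
    ext a
    refine (h (w a) (-v a) ?_).1
    ext b
    simp
    linarith [h1 a b]
  simpa using (h 0 1 (by simp [hw])).2

end Auxiliary

section Mutation

variable {K σ F : Type*} [CommRing K] [Field F] [Algebra K F] {y : σ → F} [Fintype σ]

/-- The exchange binomial with exponent vector `v`. -/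
noncomputable def bin (y : σ → F) (v : σ → ℤ) : F :=
  mon y (fun l => max (v l) 0) + mon y (fun l => max (-v l) 0)

theorem bin_neg (v : σ → ℤ) : bin y (-v) = bin y v := by
  simp [bin, add_comm]

theorem bin_eq_mul (hy : ∀ i, y i ≠ 0) (v : σ → ℤ) :
    bin y v = mon y (fun l => max (-v l) 0) * (1 + mon y v) := by
  have : (fun l => max (v l) 0) = (fun l => max (-v l) 0) + v := by
    ext l
    simp only [Pi.add_apply]
    rcases le_total (v l) 0 with h | h
    · simp [h]
    · simp [h]
  rw [bin, this, mon_add hy]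
  ring

theorem bin_mem (v : σ → ℤ) : bin y v ∈ laurent K y := add_mem (mon_mem _) (mon_mem _)

theorem bin_ne_zero [Nontrivial K] (hy : AlgebraicIndependent K y) {v : σ → ℤ} (hv : v ≠ 0) :
    bin y v ≠ 0 := by
  rw [bin_eq_mul fun i => hy.ne_zero i]
  refine mul_ne_zero (mon_ne_zero (fun i => hy.ne_zero i) _) ?_
  rw [← mon_zero (y := y)]
  exact mon_add_mon_ne_zero hy hv.symm

theorem inv_bin_not_mem [IsDomain K] (hy : AlgebraicIndependent K y) {v : σ → ℤ} (hv : v ≠ 0) :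
    (bin y v)⁻¹ ∉ laurent K y := by
  refine inv_mon_add_mon_not_mem hy fun h => hv (funext fun l => ?_)
  have := congrFun h l
  simp only [Pi.zero_apply]
  omega

theorem mon_mem_adjoin_image {k : σ} {v : σ → ℤ} (hv : v k = 0) (hv' : ∀ l, 0 ≤ v l) :
    mon y v ∈ Algebra.adjoin K (y '' {k}ᶜ) := by
  refine prod_mem fun l _ => ?_
  rcases eq_or_ne l k with rfl | h
  · simp [hv]
  · obtain ⟨n, hn⟩ := Int.eq_ofNat_of_zero_le (hv' l)
    rw [hn, zpow_natCast]
    exact pow_mem (Algebra.subset_adjoin (s := y '' {k}ᶜ) ⟨l, h, rfl⟩) _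

theorem bin_mem_adjoin_image {k : σ} {v : σ → ℤ} (hv : v k = 0) :
    bin y v ∈ Algebra.adjoin K (y '' {k}ᶜ) :=
  add_mem (mon_mem_adjoin_image (by simp [hv]) (by simp))
    (mon_mem_adjoin_image (by simp [hv]) (by simp))

variable [DecidableEq σ]

theorem bin_update {k : σ} {v : σ → ℤ} (hv : v k = 0) (a : F) :
    bin (Function.update y k a) v = bin y v := by
  rw [bin, bin, mon_update (by simp [hv]), mon_update (by simp [hv])]

/-- Replacing `y_k` by `bin y v / y_k`. -/
noncomputable def mutVar (y : σ → F) (k : σ) (v : σ → ℤ) : σ → F :=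
  Function.update y k (bin y v / y k)

theorem mutVar_self (k : σ) (v : σ → ℤ) : mutVar y k v k = bin y v / y k := by simp [mutVar]

theorem mutVar_of_ne {k l : σ} (h : l ≠ k) (v : σ → ℤ) : mutVar y k v l = y l := by
  simp [mutVar, h]

theorem mon_mutVar {k : σ} {v e : σ → ℤ} (he : e k = 0) : mon (mutVar y k v) e = mon y e :=
  mon_update he _

theorem bin_mutVar {k : σ} {v e : σ → ℤ} (he : e k = 0) : bin (mutVar y k v) e = bin y e :=
  bin_update he _

/-- The product of the old and new variable is a nonzero element of the ring generated by the
others, so one is transcendental over that ring exactly if the other is. -/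
theorem algebraicIndependent_mutVar [IsDomain K] (hy : AlgebraicIndependent K y) {k : σ}
    {v : σ → ℤ} (hv : v k = 0) (hv0 : v ≠ 0) : AlgebraicIndependent K (mutVar y k v) := by
  have himg : mutVar y k v '' {k}ᶜ = y '' {k}ᶜ :=
    Set.image_congr fun l hl => mutVar_of_ne hl v
  obtain ⟨h1, h2⟩ := (AlgebraicIndependent.iff_transcendental_adjoin_image k).1 hy
  rw [AlgebraicIndependent.iff_transcendental_adjoin_image k, himg]
  refine ⟨?_, fun h => h2 ?_⟩
  · convert h1 using 2 with l
    exact mutVar_of_ne l.2 v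
  · have hb : IsAlgebraic (Algebra.adjoin K (y '' {k}ᶜ)) (bin y v) :=
      isAlgebraic_algebraMap (⟨_, bin_mem_adjoin_image hv⟩ : Algebra.adjoin K (y '' {k}ᶜ))
    have := hb.mul h.inv
    rwa [mutVar_self, inv_div, mul_div_cancel₀ _ (bin_ne_zero hy hv0)] at this

theorem mutVar_neg (k : σ) (v : σ → ℤ) : mutVar y k (-v) = mutVar y k v := by
  rw [mutVar, mutVar, bin_neg]

variable {i k : σ} {v w w' : σ → ℤ}

/-- Over the target ring, elements of the first ring have only powers of `1 + mon y1 w'` as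
denominators, elements of the second only powers of `y k * mutVar y i w i`. Coprimality removes
both. -/
theorem mem_laurent_of_sep [IsDomain K] (hik : i ≠ k)
    (hy0 : ∀ l, y l ≠ 0) (hy1 : ∀ l, mutVar y k v l ≠ 0) (hw' : w' i = 0)
    (hk : y k ∈ laurent K (mutVar (mutVar y k v) i w'))
    (hi : mutVar y i w i ∈ laurent K (mutVar (mutVar y k v) i w'))
    (hne : mutVar y i w i ≠ 0)
    (hy3 : mutVar (mutVar y k v) i w' i ≠ 0)
    (hsep : Sep (laurent K (mutVar (mutVar y k v) i w'))
      (1 + mon (mutVar y k v) w') (y k * mutVar y i w i)) {f : F}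
    (hf1 : f ∈ laurent K (mutVar y k v)) (hf2 : f ∈ laurent K (mutVar y i w)) :
    f ∈ laurent K (mutVar (mutVar y k v) i w') := by
  set y1 := mutVar y k v with hy1d
  set y3 := mutVar y1 i w' with hy3d
  have h1l : ∀ l, l ≠ k → y1 l = y l := fun l hl => mutVar_of_ne hl v
  have h3l : ∀ l, l ≠ i → y3 l = y1 l := fun l hl => mutVar_of_ne hl w'
  set p := 1 + mon y1 w' with hp
  have hmon (e : σ → ℤ) (he : e i = 0) : mon y1 e ∈ laurent K y3 := by
    rw [← mon_mutVar he]; exact mon_mem e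
  have hpL : p ∈ laurent K y3 := add_mem (one_mem _) (hmon _ hw')
  set a := mon y1 (fun l => max (-w' l) 0) with ha
  have ha0 : a ≠ 0 := mon_ne_zero hy1 _
  have haL : a ∈ laurent K y3 := hmon _ (by simp [hw'])
  have haL' : a⁻¹ ∈ laurent K y3 := by rw [ha, ← mon_neg]; exact hmon _ (by simp [hw'])
  have h3i : y3 i = a * p / y1 i := by rw [hy3d, mutVar_self, bin_eq_mul hy1]
  have hp0 : p ≠ 0 := fun h => hy3 (by rw [h3i, h]; simp)
  have hyi : y1 i = a * p * (y3 i)⁻¹ := by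
    rw [h3i, inv_div, mul_div_cancel₀ _ (mul_ne_zero ha0 hp0)]
  obtain ⟨N, hN⟩ := exists_pow_mul_mem hpL (y' := y1) (fun l => by
      rcases eq_or_ne l i with rfl | hl
      · rw [hyi]; exact mul_mem (mul_mem haL hpL) (inv_mem_laurent _)
      · rw [← h3l l hl]; exact mem_laurent l) (fun l => by
      rcases eq_or_ne l i with rfl | hl
      · right
        have : p * (y1 l)⁻¹ = a⁻¹ * y3 l := by rw [hyi]; field_simp
        rw [this]
        exact mul_mem haL' (mem_laurent _)
      · left; rw [← h3l l hl]; exact inv_mem_laurent l) hf1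
  obtain ⟨M, hM⟩ := exists_pow_mul_mem (mul_mem hk hi) (y' := mutVar y i w) (fun l => by
      rcases eq_or_ne l i with rfl | hl
      · exact hi
      rw [mutVar_of_ne hl]
      rcases eq_or_ne l k with rfl | hl'
      · exact hk
      · rw [← h1l l hl', ← h3l l hl]; exact mem_laurent l) (fun l => by
      rcases eq_or_ne l i with rfl | hl
      · right
        rw [mul_assoc, mul_inv_cancel₀ hne, mul_one]
        exact hk
      rw [mutVar_of_ne hl]
      rcases eq_or_ne l k with rfl | hl'
      · right
        rw [mul_comm, inv_mul_cancel_left₀ (hy0 l)]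
        exact hi
      · left
        rw [← h1l l hl', ← h3l l hl]; exact inv_mem_laurent l) hf2
  exact hsep.pow_pow hpL (mul_mem hk hi) N M f hN hM

/-- Everything is computed modulo `p = 1 + h`, which divides `y i`. There `y k` is a unit. So is the
new `i`-th variable if `v i < -1`; if `v i = -1` it is, up to a unit, a two-term element separated
from `p` by the degree in `y3 i`. -/
theorem mem_laurent_mutVar_mutVar_of_pos [IsDomain K] [UniqueFactorizationMonoid K]
    (hy : AlgebraicIndependent K y) (hik : i ≠ k) (hv : v k = 0) (hw : w i = 0)
    (hwk : 0 < w k) (hvi : v i < 0) {f : F}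
    (hf1 : f ∈ laurent K (mutVar y k v)) (hf2 : f ∈ laurent K (mutVar y i w)) :
    f ∈ laurent K (mutVar (mutVar y k v) i (mutCol k v w)) := by
  have hv0 : v ≠ 0 := fun h => by simp [h] at hvi
  have hw0 : w ≠ 0 := fun h => by simp [h] at hwk
  have hw'i : mutCol k v w i = 0 := by
    have : v i * w k ≤ 0 := by nlinarith
    simp [mutCol, hik, hw, this]
  have hw'0 : mutCol k v w ≠ 0 := fun h => by
    have := congrFun h k
    simp [mutCol] at this
    omega
  have hy1 := algebraicIndependent_mutVar hy hv hv0
  have hy2 := algebraicIndependent_mutVar hy hw hw0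
  have hy3 := algebraicIndependent_mutVar hy1 hw'i hw'0
  have hy0' : ∀ l, y l ≠ 0 := fun l => hy.ne_zero l
  have hy1' : ∀ l, mutVar y k v l ≠ 0 := fun l => hy1.ne_zero l
  have hy3' : ∀ l, mutVar (mutVar y k v) i (mutCol k v w) l ≠ 0 := fun l => hy3.ne_zero l
  obtain ⟨β, hβ⟩ := Int.eq_ofNat_of_zero_le hwk.le
  -- The shift by one leaves the natural exponent `γ` of `y i` after the division by `y i` in `h2i`.
  obtain ⟨γ, hγ⟩ : ∃ γ : ℕ, v i = -((γ : ℤ) + 1) := ⟨(-v i - 1).toNat, by omega⟩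
  -- monomials in the variables other than `y_i` and `y_k`
  have hm3 (e : σ → ℤ) (hi : e i = 0) (hk : e k = 0) :
      mon (mutVar (mutVar y k v) i (mutCol k v w)) e = mon y e := by
    rw [mon_mutVar hi, mon_mutVar hk]
  set w' := mutCol k v w with hw'd
  set y1 := mutVar y k v with hy1d
  set y3 := mutVar y1 i w' with hy3d
  set L := laurent K y3 with hLd
  have hmL (e : σ → ℤ) (hi : e i = 0) (hk : e k = 0) : mon y e ∈ L := by
    rw [← hm3 e hi hk]; exact mon_mem e
  -- the coefficients
  set a := mon y1 (fun l => max (-w' l) 0) with ha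
  have ha3 : a = mon y3 (fun l => max (-w' l) 0) := by rw [hy3d, mon_mutVar (by simp [hw'i])]
  have haL : a ∈ L := by rw [ha3]; exact mon_mem _
  have ha0 : a ≠ 0 := mon_ne_zero hy1' _
  set h := mon y1 w' with hh
  have hh3 : h = mon y3 w' := by rw [hy3d, mon_mutVar hw'i]
  have hhL : h ∈ L := by rw [hh3]; exact mon_mem _
  set p := 1 + h with hp
  have hpL : p ∈ L := add_mem (one_mem _) hhL
  have h3i : y3 i = a * p / y i := by
    rw [hy3d, mutVar_self, bin_eq_mul hy1', hy1d, mutVar_of_ne hik]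
  have hp0 : p ≠ 0 := fun h => hy3' i (by rw [h3i, h]; simp)
  have hyi : y i = a * (y3 i)⁻¹ * p := by
    rw [h3i, inv_div]; field_simp
  set r : σ → ℤ := Function.update (-v) i 0 with hr
  have hri : r i = 0 := by simp [hr]
  have hrk : r k = 0 := by simp [hr, hik.symm, hv]
  set c := mon y r with hc
  have hc3 : c = mon y3 r := (hm3 r hri hrk).symm
  have hcL : c ∈ L := hmL r hri hrk
  have hζ : mon y (-v) = c * y i ^ (γ + 1) := by
    have : -v = r + Pi.single i ((γ + 1 : ℕ) : ℤ) := by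
      ext l
      rcases eq_or_ne l i with rfl | hl
      · simp [hr, hγ]
      · simp [hr, hl]
    rw [this, mon_add hy0', mon_single, zpow_natCast]
  set ζ := mon y (-v) with hζd
  have hyiL : y i ∈ L := by
    rw [hyi]; exact mul_mem (mul_mem haL (inv_mem_laurent _)) hpL
  have hζL : ζ ∈ L := by rw [hζ]; exact mul_mem hcL (pow_mem hyiL _)
  set m1 := mon y (fun l => max (v l) 0) with hm1
  have hm1L : m1 ∈ L := hmL _ (by simp [hvi.le]) (by simp [hv])
  have hm1L' : m1⁻¹ ∈ L := by
    rw [hm1, ← mon_neg]; exact hmL _ (by simp [hvi.le]) (by simp [hv])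
  have hm10 : m1 ≠ 0 := mon_ne_zero hy0' _
  have hbv : bin y v = m1 * (1 + ζ) := by
    rw [← bin_neg, bin_eq_mul hy0']; simp [hm1, hζd]
  have h3k : y3 k = m1 * (1 + ζ) / y k := by
    rw [hy3d, mutVar_of_ne hik.symm, hy1d, mutVar_self, hbv]
  have h1k : y1 k = m1 * (1 + ζ) / y k := by rw [hy1d, mutVar_self, hbv]
  have hyk : y k = m1 * (1 + ζ) * (y3 k)⁻¹ := by
    have h1 : m1 * (1 + ζ) ≠ 0 := fun h => hy3' k (by rw [h3k, h]; simp)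
    rw [h3k, inv_div, mul_div_cancel₀ _ h1]
  have hykL : y k ∈ L := by
    rw [hyk]
    exact mul_mem (mul_mem hm1L (add_mem (one_mem _) hζL)) (inv_mem_laurent _)
  set m2 := mon y (fun l => max (-w l) 0) with hm2
  have hm2L : m2 ∈ L := hmL _ (by simp [hw]) (by simp [hwk.le])
  have hm2L' : m2⁻¹ ∈ L := by
    rw [hm2, ← mon_neg]; exact hmL _ (by simp [hw]) (by simp [hwk.le])
  have hm20 : m2 ≠ 0 := mon_ne_zero hy0' _
  -- Mutation inverts the exponent of the `k`-th variable and adds `β` copies of the positive part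
  -- of `v`; since `y k * y1 k = m1 * (1 + ζ)`, the powers of `m1` cancel.
  have hmw : mon y w = h * (1 + ζ) ^ β := by
    have e1 : w = Function.update w k 0 + Pi.single k (β : ℤ) := by
      ext l
      rcases eq_or_ne l k with rfl | hl
      · simp [hβ]
      · simp [hl]
    have e2 : w' = Function.update w k 0 + Pi.single k (-(β : ℤ)) + β • fun l => max (v l) 0 := by
      ext l
      rcases eq_or_ne l k with rfl | hl
      · simp [hw'd, mutCol, hv, hβ]
      · simp only [hw'd, mutCol, hl, if_false, hβ, Pi.add_apply, Function.update_of_ne hl,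
          Pi.single_eq_of_ne hl, add_zero, nsmul_eq_mul, add_right_inj]
        rcases lt_trichotomy (v l) 0 with h0 | h0 | h0
        · have : v l * (β : ℤ) ≤ 0 := by nlinarith
          simp [this, h0.le]
        · simp [h0]
        · have : 0 ≤ v l * (β : ℤ) := by positivity
          change _ = (β : ℤ) * max (v l) 0
          rw [max_eq_left this, max_eq_left h0.le, Int.sign_eq_one_of_pos h0]
          ring
    rw [hh, e2, mon_add hy1', mon_add hy1', mon_smul, mon_single]
    nth_rewrite 1 [e1]
    rw [mon_add hy0', mon_single, hy1d, mon_mutVar (by simp), mon_mutVar (by simp [hv]), ← hy1d,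
      ← hm1, zpow_neg, zpow_natCast, zpow_natCast, mul_assoc, mul_assoc]
    congr 1
    rw [h1k, div_pow, mul_pow]
    have h2 : (1 + ζ) ≠ 0 := fun h => hy3' k (by rw [h3k, h]; simp)
    have := hy0' k
    field_simp
  obtain ⟨G, hGL, hG⟩ := exists_one_add_pow_eq hζL β
  -- Expand `1 + h * (1 + ζ) ^ β` as `p + h * ζ * (β + ζ * G)` and divide by `y i`: the first term
  -- becomes `a⁻¹ * y3 i`, and `ζ` loses one factor `y i`.
  have h2i : mutVar y i w i = m2 * (a⁻¹ * y3 i + h * c * y i ^ γ * (β + ζ * G)) := by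
    rw [mutVar_self, bin_eq_mul hy0', ← hm2, hmw, hG, h3i]
    have := hy0' i
    field_simp
    linear_combination (h * (β + ζ * G)) * hζ
  have haL' : a⁻¹ ∈ L := by rw [ha3, ← mon_neg]; exact mon_mem _
  have h2iL : mutVar y i w i ∈ L := by
    rw [h2i]
    exact mul_mem hm2L (add_mem (mul_mem haL' (mem_laurent _))
      (mul_mem (mul_mem (mul_mem hhL hcL) (pow_mem hyiL _))
        (add_mem (natCast_mem _ _) (mul_mem hζL hGL))))
  have hu0L : a * (y3 i)⁻¹ ∈ L := mul_mem haL (inv_mem_laurent _)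
  -- `ζ` is a multiple of `p`, so `y3 k * m1⁻¹ * y k = 1 + ζ` is `1` modulo `p`.
  have hsk : Sep L p (y k) := by
    refine sep_one.of_eq (u := y3 k * m1⁻¹) (c := -(c * y i ^ γ * (a * (y3 i)⁻¹)))
      (mul_mem (mem_laurent _) hm1L')
      (neg_mem (mul_mem (mul_mem hcL (pow_mem hyiL _)) hu0L)) ?_
    have e1 : y3 k * m1⁻¹ * y k = 1 + ζ := by
      rw [hyk]; have := hy3' k; field_simp
    have e2 : c * y i ^ γ * (a * (y3 i)⁻¹) * p = ζ := by
      rw [hζ, pow_succ]; nth_rewrite 3 [hyi]; ring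
    rw [e1, neg_mul, e2]; ring
  have hsi : Sep L p (mutVar y i w i) := by
    rcases γ with _ | γ
    · have hs := sep_binomial hy3 (φ := Pi.single i 1) (w := w')
        (a := Pi.single i 1 - fun l => max (-w' l) 0) (b := w' + r) hw'0
        (by simp [Pi.single_apply, hw'i]) (by simp [Pi.single_apply, hw'i, hri]) (β : K)
      have e1 : mon y3 (Pi.single i 1 - fun l => max (-w' l) 0) = a⁻¹ * y3 i := by
        rw [sub_eq_add_neg, mon_add hy3', mon_neg, ← ha3, mon_single]; simp [mul_comm]
      rw [e1, mon_add hy3', ← hh3, ← hc3] at hs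
      refine hs.of_eq (u := m2⁻¹) (c := -(h * c * (c * (a * (y3 i)⁻¹)) * G)) hm2L'
        (neg_mem (mul_mem (mul_mem (mul_mem hhL hcL) (mul_mem hcL hu0L)) hGL)) ?_
      have e2 : ζ = c * (a * (y3 i)⁻¹) * p := by
        rw [hζ, zero_add, pow_one]; nth_rewrite 1 [hyi]; ring
      rw [h2i, inv_mul_cancel_left₀ hm20, e2, map_natCast]
      ring
    -- For positive exponent the second summand of `h2i` still contains `y i`, hence vanishes modulo
    -- `p`, and the unit `m2 * a⁻¹ * y3 i` remains.
    · refine sep_one.of_eq (u := a * (y3 i)⁻¹ * m2⁻¹)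
        (c := -(a * (y3 i)⁻¹ * (h * c * y i ^ γ * (a * (y3 i)⁻¹) * (β + ζ * G))))
        (mul_mem hu0L hm2L')
        (neg_mem (mul_mem hu0L (mul_mem (mul_mem (mul_mem (mul_mem hhL hcL) (pow_mem hyiL _)) hu0L)
          (add_mem (natCast_mem _ _) (mul_mem hζL hGL))))) ?_
      rw [h2i, pow_succ]
      nth_rewrite 2 [hyi]
      have := hy3' i
      field_simp
      ring
  exact mem_laurent_of_sep hik hy0' hy1' hw'i hykL h2iL (hy2.ne_zero i) (hy3' i)
    (hsk.mul hsi h2iL) hf1 hf2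

/-- The two mutations commute and the new `i`-th variable is a unit in the target, so it remains to
separate `1 + mon y w` from `1 + mon y v`. The weight `φ`, obtained from independence of the
columns, does that. -/
theorem mem_laurent_mutVar_mutVar_of_zero [IsDomain K] [UniqueFactorizationMonoid K]
    (hy : AlgebraicIndependent K y) (hik : i ≠ k) (hv : v k = 0) (hw : w i = 0)
    (hwk : w k = 0) (hvi : v i = 0) {φ : σ → ℤ} (hφw : ∑ l, φ l * w l = 0)
    (hφv : ∑ l, φ l * v l ≠ 0) (hw0 : w ≠ 0) {f : F}
    (hf1 : f ∈ laurent K (mutVar y k v)) (hf2 : f ∈ laurent K (mutVar y i w)) :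
    f ∈ laurent K (mutVar (mutVar y k v) i (mutCol k v w)) := by
  have hv0 : v ≠ 0 := fun h => hφv (by simp [h])
  have hw' : mutCol k v w = w := by
    ext l
    rcases eq_or_ne l k with rfl | hl
    · simp [mutCol, hwk]
    · simp [mutCol, hl, hwk]
  rw [hw']
  have hy1 := algebraicIndependent_mutVar hy hv hv0
  have hy2 := algebraicIndependent_mutVar hy hw hw0
  have hy3 := algebraicIndependent_mutVar hy1 hw hw0
  have hy0' : ∀ l, y l ≠ 0 := fun l => hy.ne_zero l
  have hm3 (e : σ → ℤ) (hi : e i = 0) (hk : e k = 0) :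
      mon (mutVar (mutVar y k v) i w) e = mon y e := by
    rw [mon_mutVar hi, mon_mutVar hk]
  have h2i : mutVar y i w i = mutVar (mutVar y k v) i w i := by
    rw [mutVar_self, mutVar_self, bin_mutVar hwk, mutVar_of_ne hik]
  have h3k : mutVar (mutVar y k v) i w k = bin y v / y k := by
    rw [mutVar_of_ne hik.symm, mutVar_self]
  have hyk : y k = bin y v * (mutVar (mutVar y k v) i w k)⁻¹ := by
    rw [h3k, inv_div, mul_div_cancel₀ _ (bin_ne_zero hy hv0)]
  have hbL : bin y v ∈ laurent K (mutVar (mutVar y k v) i w) := by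
    rw [← bin_mutVar (k := k) (v := v) hv, ← bin_mutVar (k := i) (v := w) hvi]; exact bin_mem v
  have hkL : y k ∈ laurent K (mutVar (mutVar y k v) i w) := by
    rw [hyk]; exact mul_mem hbL (inv_mem_laurent _)
  have hiL : mutVar y i w i ∈ laurent K (mutVar (mutVar y k v) i w) := by
    rw [h2i]; exact mem_laurent i
  refine mem_laurent_of_sep hik hy0' (fun l => hy1.ne_zero l) hw hkL hiL
    (hy2.ne_zero i) (hy3.ne_zero i) ?_ hf1 hf2
  have hs := sep_binomial hy3 (φ := φ) (w := w) (a := 0) (b := v) hw0 hφw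
    (by simpa using hφv.symm) (1 : K)
  rw [map_one, one_mul, mon_zero, hm3 w hw hwk, hm3 v hvi hv] at hs
  rw [mon_mutVar hwk]
  have hsk : Sep (laurent K (mutVar (mutVar y k v) i w)) (1 + mon y w) (y k) := by
    refine hs.of_eq (u := mutVar (mutVar y k v) i w k * (mon y fun l => max (-v l) 0)⁻¹) (c := 0)
      (mul_mem (mem_laurent _) ?_) (zero_mem _) ?_
    · rw [← mon_neg, ← hm3 _ (by simp [hvi]) (by simp [hv])]; exact mon_mem _
    · have h1 := mon_ne_zero hy0' fun l => max (-v l) 0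
      have h2 := hy0' k
      rw [h3k, bin_eq_mul hy0']
      field_simp
      ring
  refine hsk.mul (sep_one.of_eq (u := (mutVar y i w i)⁻¹) (c := 0) ?_ (zero_mem _) ?_) hiL
  · rw [h2i]; exact inv_mem_laurent i
  · have := hy2.ne_zero i
    field_simp
    ring

/-- The rank two case of the invariance of upper bounds under mutation. -/
theorem mem_laurent_mutVar_mutVar [IsDomain K] [UniqueFactorizationMonoid K]
    (hy : AlgebraicIndependent K y) (hik : i ≠ k) (hv : v k = 0) (hw : w i = 0)
    (hsign : 0 < w k ∧ v i < 0 ∨ w k < 0 ∧ 0 < v i ∨ w k = 0 ∧ v i = 0)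
    (hind : ∀ a b : ℤ, a • v + b • w = 0 → a = 0 ∧ b = 0) {f : F}
    (hf1 : f ∈ laurent K (mutVar y k v)) (hf2 : f ∈ laurent K (mutVar y i w)) :
    f ∈ laurent K (mutVar (mutVar y k v) i (mutCol k v w)) := by
  rcases hsign with ⟨h1, h2⟩ | ⟨h1, h2⟩ | ⟨h1, h2⟩
  · exact mem_laurent_mutVar_mutVar_of_pos hy hik hv hw h1 h2 hf1 hf2
  · rw [← mutVar_neg] at hf1 hf2
    have := mem_laurent_mutVar_mutVar_of_pos hy hik (v := -v) (w := -w) (by simp [hv])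
      (by simp [hw]) (by simpa using h1) (by simpa using h2) hf1 hf2
    rwa [mutCol_neg, mutVar_neg, mutVar_neg] at this
  · obtain ⟨φ, hφw, hφv⟩ := exists_weight hind
    refine mem_laurent_mutVar_mutVar_of_zero hy hik hv hw h1 h2 hφw hφv ?_ hf1 hf2
    rintro rfl
    simpa using (hind 0 1 (by simp)).2

end Mutation
end ClusterAlgebra

/-! ### Nagata's criterion. -/

namespace ClusterAlgebra

section Nagata

variable {R S : Type*} [CommRing R] [IsDomain R] [CommRing S] [IsDomain S]

theorem dvd_of_dvd_prime_pow_mul {a b p : R} (hp : Prime p) (ha : ¬ p ∣ a) (N : ℕ)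
    (h : a ∣ p ^ N * b) : a ∣ b := by
  induction N with
  | zero => simpa using h
  | succ N ih =>
    refine ih ?_
    rw [pow_succ', mul_assoc] at h
    obtain ⟨c, hc⟩ := h
    obtain ⟨d, rfl⟩ := (hp.dvd_or_dvd ⟨_, hc.symm⟩).resolve_left ha
    exact ⟨d, mul_left_cancel₀ hp.ne_zero (by rw [hc]; ring)⟩

theorem dvd_of_dvd_prod_prime_pow_mul {ι : Type*} {p : ι → R} (hp : ∀ i, Prime (p i)) {a b : R}
    (ha : ∀ i, ¬ p i ∣ a) (s : Finset ι) (N : ℕ) (h : a ∣ (∏ i ∈ s, p i) ^ N * b) : a ∣ b := by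
  classical
  induction s using Finset.induction_on generalizing b with
  | empty => simpa using h
  | insert i s hi ih =>
    rw [Finset.prod_insert hi, mul_pow, mul_assoc] at h
    exact ih (dvd_of_dvd_prime_pow_mul (hp i) (ha i) N h)

theorem exists_primes_mul_not_dvd {R ι : Type*} [CommRing R] {p : ι → R}
    (hfin : ∀ i a, a ≠ 0 → FiniteMultiplicity (p i) a) (s : Finset ι) {a : R} (ha : a ≠ 0) :
    ∃ (f : Multiset R) (a' : R), (∀ q ∈ f, ∃ i, q = p i) ∧ a = f.prod * a' ∧ ∀ i ∈ s, ¬ p i ∣ a' := by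
  classical
  induction s using Finset.induction_on with
  | empty => exact ⟨0, a, by simp, by simp, by simp⟩
  | insert i s _ ih =>
    obtain ⟨f, a', hf, rfl, hs⟩ := ih
    obtain ⟨c, hc, hc'⟩ := (hfin i a' (right_ne_zero_of_mul ha)).exists_eq_pow_mul_and_not_dvd
    refine ⟨f + Multiset.replicate (multiplicity (p i) a') (p i), c, ?_, ?_, ?_⟩
    · intro q hq
      rcases Multiset.mem_add.1 hq with hq | hq
      · exact hf q hq
      · exact ⟨i, Multiset.eq_of_mem_replicate hq⟩
    · rw [Multiset.prod_add, Multiset.prod_replicate, mul_assoc, ← hc]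
    · intro j hj
      rcases Finset.mem_insert.1 hj with rfl | hj
      · exact hc'
      · intro hd
        exact hs j hj (hc ▸ hd.mul_left _)

/-- Nagata's criterion: if inverting finitely many primes of finite multiplicity makes a domain
factorial, then the domain is factorial. -/
theorem uniqueFactorizationMonoid_of_inverting_primes [UniqueFactorizationMonoid S]
    (j : R →+* S) (hj : Function.Injective j) {ι : Type*} [Fintype ι] {p : ι → R}
    (hp : ∀ i, Prime (p i)) (hunit : ∀ i, IsUnit (j (p i)))
    (hfin : ∀ i a, a ≠ 0 → FiniteMultiplicity (p i) a)
    (hsurj : ∀ s, ∃ (N : ℕ) (r : R), j (∏ i, p i) ^ N * s = j r) :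
    UniqueFactorizationMonoid R := by
  classical
  have hprod : IsUnit (j (∏ i, p i)) := by
    rw [map_prod]
    exact Finset.prod_induction _ IsUnit (fun _ _ => IsUnit.mul) isUnit_one fun i _ => hunit i
  -- Divisibility descends from `S` for elements free of the inverted primes; the denominator of the
  -- quotient is cancelled prime by prime.
  have hdvd {a b : R} (ha : ∀ i, ¬ p i ∣ a) (h : j a ∣ j b) : a ∣ b := by
    obtain ⟨s, hs⟩ := h
    obtain ⟨N, r, hr⟩ := hsurj s
    refine dvd_of_dvd_prod_prime_pow_mul hp ha Finset.univ N ⟨r, hj ?_⟩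
    rw [map_mul, map_mul, map_pow, hs, ← hr]
    ring
  -- Clear denominators of `q` and strip off the inverted primes; the result is associated to `q` in
  -- `S` and prime in `R` by `hdvd`.
  have hprime (q : S) (hq : Prime q) :
      ∃ r : R, Prime r ∧ (∀ i, ¬ p i ∣ r) ∧ Associated (j r) q := by
    obtain ⟨N, r, hr⟩ := hsurj q
    have hr0 : r ≠ 0 := by
      rintro rfl
      rw [map_zero] at hr
      exact mul_ne_zero (pow_ne_zero _ hprod.ne_zero) hq.ne_zero hr
    have hrq : Associated (j r) q := by
      rw [← hr]
      exact associated_unit_mul_left _ _ (hprod.pow N)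
    obtain ⟨f, a, hf, rfl, ha⟩ := exists_primes_mul_not_dvd hfin Finset.univ hr0
    have hfu : IsUnit (j f.prod) := by
      rw [map_multiset_prod, IsUnit.multisetProd_iff]
      intro x hx
      obtain ⟨y, hy, rfl⟩ := Multiset.mem_map.1 hx
      obtain ⟨i, rfl⟩ := hf y hy
      exact hunit i
    have haq : Associated (j a) q := by
      refine .trans ?_ hrq
      rw [map_mul]
      exact (associated_unit_mul_left _ _ hfu).symm
    have hja : Prime (j a) := haq.symm.prime hq
    have ha' : ∀ i, ¬ p i ∣ a := fun i => ha i (Finset.mem_univ i)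
    refine ⟨a, ⟨right_ne_zero_of_mul hr0, fun h => hja.not_isUnit (h.map j), fun x y h => ?_⟩,
      ha', haq⟩
    have := map_dvd j h
    rw [map_mul] at this
    exact (hja.dvd_or_dvd this).imp (hdvd ha') (hdvd ha')
  refine .of_exists_prime_factors fun a ha => ?_
  obtain ⟨f, b, hf, rfl, hb⟩ := exists_primes_mul_not_dvd hfin Finset.univ ha
  have hb0 : j b ≠ 0 := (map_ne_zero_iff j hj).2 (right_ne_zero_of_mul ha)
  obtain ⟨g, hg, hgb⟩ := UniqueFactorizationMonoid.exists_prime_factors (j b) hb0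
  choose! r hr1 hr2 hr3 using hprime
  have hgr : Associated (j (g.map r).prod) (j b) := by
    refine .trans ?_ hgb
    clear hgb
    induction g using Multiset.induction_on with
    | empty => simp
    | cons q g ih =>
      rw [Multiset.map_cons, Multiset.prod_cons, Multiset.prod_cons, map_mul]
      exact (hr3 q (hg q (Multiset.mem_cons_self _ _))).mul_mul
        (ih fun b hb => hg b (Multiset.mem_cons_of_mem hb))
  have hndvd : ∀ i, ¬ p i ∣ (g.map r).prod := by
    intro i hi
    obtain ⟨q, hq, hqi⟩ := (hp i).exists_mem_multiset_dvd hi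
    obtain ⟨b, hb, rfl⟩ := Multiset.mem_map.1 hq
    exact hr2 b (hg b hb) i hqi
  refine ⟨f + g.map r, ?_, ?_⟩
  · intro q hq
    rcases Multiset.mem_add.1 hq with hq | hq
    · obtain ⟨i, rfl⟩ := hf q hq
      exact hp i
    · obtain ⟨b, hb, rfl⟩ := Multiset.mem_map.1 hq
      exact hr1 b (hg b hb)
  · rw [Multiset.prod_add]
    exact .mul_left _ (associated_of_dvd_dvd (hdvd hndvd hgr.dvd)
      (hdvd (fun i => hb i (Finset.mem_univ i)) hgr.symm.dvd))

end Nagata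
end ClusterAlgebra

/-! ### Seeds in extended coordinates; nondegeneracy under mutation. -/

namespace ClusterAlgebra

namespace SeedData

section Coordinates

variable {K : Type*} [CommRing K] {n m : ℕ} {F : Type*} [Field F]
  [Algebra (MonoidAlgebra K (Trop m)) F]

variable (K) in
/-- The cluster variables together with the generators of the tropical semifield. -/
noncomputable def coords (t : SeedData n (Trop m) F) : Fin n ⊕ Fin m → F :=
  Sum.elim t.A fun i =>
    algebraMap (MonoidAlgebra K (Trop m)) F (MonoidAlgebra.of K (Trop m) (Trop.gen i))

/-- The `k`-th column of the extended exchange matrix. -/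
def col {F : Type*} (t : SeedData n (Trop m) F) (k : Fin n) : Fin n ⊕ Fin m → ℤ :=
  Sum.elim (fun j => t.B j k) fun i => (t.X k).toAdd i

theorem _root_.ClusterAlgebra.Trop.eq_prod_gen (p : Trop m) :
    p = ∏ i, Trop.gen i ^ p.toAdd i := by
  apply Multiplicative.toAdd.injective
  ext j
  simp [Trop.gen, toAdd_prod, Pi.single_apply]

theorem algebraMap_of_trop (p : Trop m) :
    algebraMap (MonoidAlgebra K (Trop m)) F (MonoidAlgebra.of K (Trop m) p) =
      ∏ i, (algebraMap (MonoidAlgebra K (Trop m)) F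
        (MonoidAlgebra.of K (Trop m) (Trop.gen i))) ^ p.toAdd i := by
  let f : Trop m →* F := (algebraMap (MonoidAlgebra K (Trop m)) F : _ →* F).comp
    (MonoidAlgebra.of K (Trop m))
  change f p = ∏ i, f (Trop.gen i) ^ p.toAdd i
  conv_lhs => rw [Trop.eq_prod_gen p]
  simp only [map_prod, map_zpow]

theorem mon_coords (t : SeedData n (Trop m) F) (v : Fin n ⊕ Fin m → ℤ) :
    mon (t.coords K) v = algebraMap (MonoidAlgebra K (Trop m)) F
      (MonoidAlgebra.of K (Trop m) (Multiplicative.ofAdd fun i => v (.inr i))) *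
        ∏ j, t.A j ^ v (.inl j) := by
  rw [algebraMap_of_trop, mon, Fintype.prod_sum_type, mul_comm]
  rfl

/-- Dividing by `1 ⊕ X_k` subtracts `min 0 c` from the exponents `c` and `0`, leaving the positive
parts of `c` and `-c`: coefficients behave like the cluster variables. -/
theorem exchangeBinomial_eq_bin (t : SeedData n (Trop m) F) (k : Fin n) :
    t.exchangeBinomial K k = bin (t.coords K) (t.col k) := by
  have h1 : t.X k / AuxAddition.oplus 1 (t.X k) =
      Multiplicative.ofAdd fun i => max (t.col k (.inr i)) 0 := by
    apply Multiplicative.toAdd.injective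
    ext i
    simp only [col, Sum.elim_inr, toAdd_div, AuxAddition.oplus, toAdd_ofAdd, Pi.sub_apply,
      toAdd_one, Pi.zero_apply]
    omega
  have h2 : 1 / AuxAddition.oplus 1 (t.X k) =
      Multiplicative.ofAdd fun i => max (-t.col k (.inr i)) 0 := by
    apply Multiplicative.toAdd.injective
    ext i
    simp only [col, Sum.elim_inr, toAdd_div, AuxAddition.oplus, toAdd_ofAdd, Pi.sub_apply,
      toAdd_one, Pi.zero_apply]
    omega
  have h3 : ∏ j with 0 < t.B j k, t.A j ^ t.B j k = ∏ j, t.A j ^ max (t.col k (.inl j)) 0 := by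
    rw [Finset.prod_filter]
    refine Finset.prod_congr rfl fun j _ => ?_
    simp only [col, Sum.elim_inl]
    split_ifs with h
    · rw [max_eq_left h.le]
    · rw [max_eq_right (not_lt.1 h), zpow_zero]
  have h4 : ∏ j with t.B j k < 0, t.A j ^ (-t.B j k) =
      ∏ j, t.A j ^ max (-t.col k (.inl j)) 0 := by
    rw [Finset.prod_filter]
    refine Finset.prod_congr rfl fun j _ => ?_
    simp only [col, Sum.elim_inl]
    split_ifs with h
    · rw [max_eq_left (by omega)]
    · rw [max_eq_right (by omega), zpow_zero]
  rw [exchangeBinomial, bin, mon_coords, mon_coords, h1, h2, h3, h4]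

theorem coords_mutate (t : SeedData n (Trop m) F) (k : Fin n) :
    (t.mutate K k).coords K = mutVar (t.coords K) (.inl k) (t.col k) := by
  ext (j | i)
  · rcases eq_or_ne j k with rfl | h
    · rw [mutVar_self, ← exchangeBinomial_eq_bin]
      simp [coords, mutate, div_eq_inv_mul]
    · rw [mutVar_of_ne (by simpa using h)]
      simp [coords, mutate, h]
  · rw [mutVar_of_ne (by simp)]
    rfl

theorem col_mutate_self (t : SeedData n (Trop m) F) (k : Fin n) :
    (t.mutate K k).col k = -t.col k := by
  ext (j | i) <;> simp [col, mutate, mutateMatrix]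

/-- On exponents, tropical coefficient mutation is matrix mutation of the lower rows: `x * max b 0 -
b * min x 0 = sign x * max (x * b) 0`. -/
theorem col_mutate_of_ne (t : SeedData n (Trop m) F) {i k : Fin n} (h : i ≠ k) :
    (t.mutate K k).col i = mutCol (.inl k) (t.col k) (t.col i) := by
  ext (j | l)
  · simp [col, mutate, mutateMatrix, mutCol, h]
  · simp only [col, mutate, mutCol, h, Sum.elim_inr, if_false, reduceCtorEq, Sum.elim_inl,
      toAdd_mul, toAdd_zpow, AuxAddition.oplus, Pi.add_apply, Pi.smul_apply, smul_eq_mul,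
      toAdd_ofAdd, toAdd_one, Pi.zero_apply, add_assoc, add_right_inj]
    generalize (t.X k).toAdd l = x
    generalize t.B k i = b
    rcases lt_trichotomy x 0 with hx | rfl | hx
    · rw [min_eq_right hx.le, Int.sign_eq_neg_one_of_neg hx]
      rcases le_total b 0 with hb | hb
      · rw [max_eq_right hb, max_eq_left (mul_nonneg_of_nonpos_of_nonpos hx.le hb)]; ring
      · rw [max_eq_left hb, max_eq_right (mul_nonpos_of_nonpos_of_nonneg hx.le hb)]; ring
    · simp
    · rw [min_eq_left hx.le, Int.sign_eq_one_of_pos hx]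
      rcases le_total b 0 with hb | hb
      · rw [max_eq_right hb, max_eq_right (mul_nonpos_of_nonneg_of_nonpos hx.le hb)]; ring
      · rw [max_eq_left hb, max_eq_left (mul_nonneg hx.le hb)]; ring

theorem isSkewSymmetrizable_iff {B : Matrix (Fin n) (Fin n) ℤ} :
    IsSkewSymmetrizable B ↔
      ∃ d : Fin n → ℤ, (∀ i, 0 < d i) ∧ ∀ i j, d i * B i j = -(d j * B j i) := by
  refine exists_congr fun d => and_congr_right fun _ => ⟨fun h i j => ?_, fun h => ?_⟩
  · simpa using congrFun (congrFun h j) i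
  · ext i j
    simpa using h j i

/-- The same symmetrizer works. Opposite entries have opposite signs, so the correction terms at
`(i, j)` and `(j, i)` are both present or both zero. -/
theorem isSkewSymmetrizable_mutateMatrix {B : Matrix (Fin n) (Fin n) ℤ}
    (hB : IsSkewSymmetrizable B) (k : Fin n) : IsSkewSymmetrizable (mutateMatrix B k) := by
  rw [isSkewSymmetrizable_iff] at hB ⊢
  obtain ⟨d, hd, h⟩ := hB
  refine ⟨d, hd, fun i j => ?_⟩
  simp only [mutateMatrix, Matrix.of_apply]
  by_cases hij : i = k ∨ j = k
  · rw [if_pos hij, if_pos hij.symm]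
    linarith [h i j]
  · rw [if_neg hij, if_neg (fun h => hij h.symm)]
    have hik := h i k
    have hkj := h k j
    have h0 := h i j
    have hpos {a b x y : ℤ} (ha : 0 < a) (hb : 0 < b) (hab : a * x = -(b * y)) (hx : 0 < x) :
        y < 0 := by
      by_contra! hy
      nlinarith [mul_pos ha hx, mul_nonneg hb.le hy]
    have hneg {a b x y : ℤ} (ha : 0 < a) (hb : 0 < b) (hab : a * x = -(b * y)) (hx : x < 0) :
        0 < y := by
      have := hpos ha hb (x := -x) (y := -y) (by linarith) (by linarith)
      linarith
    have hzero {a b x y : ℤ} (hb : 0 < b) (hab : a * x = -(b * y)) (hx : x = 0) : y = 0 := by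
      subst hx
      simpa [hb.ne'] using hab
    rcases lt_trichotomy (B i k) 0 with hx | hx | hx
    · have hu := hneg (hd i) (hd k) hik hx
      rcases lt_or_ge (B k j) 0 with hy | hy
      · have hz := hneg (hd k) (hd j) hkj hy
        rw [max_eq_left (mul_pos_of_neg_of_neg hx hy).le, max_eq_left (mul_pos hz hu).le,
          Int.sign_eq_neg_one_of_neg hx, Int.sign_eq_one_of_pos hz]
        linear_combination h0 - B k j * hik + B k i * hkj
      · have hz : B j k ≤ 0 := by
          rcases hy.eq_or_lt with hy | hy
          · exact (hzero (hd j) hkj hy.symm).le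
          · exact (hpos (hd k) (hd j) hkj hy).le
        rw [max_eq_right (mul_nonpos_of_nonpos_of_nonneg hx.le hy),
          max_eq_right (mul_nonpos_of_nonpos_of_nonneg hz hu.le)]
        linear_combination h0
    · have hu := hzero (hd k) hik hx
      simp only [hx, hu, zero_mul, mul_zero, max_self, add_zero]
      exact h0
    · have hu := hpos (hd i) (hd k) hik hx
      rcases lt_or_ge 0 (B k j) with hy | hy
      · have hz := hpos (hd k) (hd j) hkj hy
        rw [max_eq_left (mul_pos hx hy).le, max_eq_left (mul_pos_of_neg_of_neg hz hu).le,
          Int.sign_eq_neg_one_of_neg hz, Int.sign_eq_one_of_pos hx]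
        linear_combination h0 + B k j * hik - B k i * hkj
      · have hz : 0 ≤ B j k := by
          rcases hy.eq_or_lt with hy | hy
          · exact (hzero (hd j) hkj hy).ge
          · exact (hneg (hd k) (hd j) hkj hy).le
        rw [max_eq_right (mul_nonpos_of_nonneg_of_nonpos hx.le hy),
          max_eq_right (mul_nonpos_of_nonneg_of_nonpos hz hu.le)]
        linear_combination h0

/-- The properties of seeds of full rank that are used below. -/
structure IsNondegenerate (K : Type*) [CommRing K] [Algebra (MonoidAlgebra K (Trop m)) F]
    [Algebra K F] (t : SeedData n (Trop m) F) : Prop where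
  skew : IsSkewSymmetrizable t.B
  algebraicIndependent : AlgebraicIndependent K (t.coords K)
  col_independent : ∀ c : Fin n → ℤ, ∑ j, c j • t.col j = 0 → c = 0

namespace IsNondegenerate

variable [Algebra K F] {t : SeedData n (Trop m) F}

theorem col_self (ht : t.IsNondegenerate K) (k : Fin n) : t.col k (.inl k) = 0 := by
  obtain ⟨d, hd, h⟩ := isSkewSymmetrizable_iff.1 ht.skew
  have := h k k
  have h2 := (hd k).ne'
  have h3 : d k * t.B k k = 0 := by linarith
  simpa [col, h2] using h3

theorem col_ne_zero (ht : t.IsNondegenerate K) (k : Fin n) : t.col k ≠ 0 := by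
  intro h
  have := ht.col_independent (Pi.single k 1) (by simp [Pi.single_apply, h])
  simpa using congrFun this k

theorem mutate [IsDomain K] (ht : t.IsNondegenerate K) (k : Fin n) :
    (t.mutate K k).IsNondegenerate K where
  skew := isSkewSymmetrizable_mutateMatrix ht.skew k
  algebraicIndependent := by
    rw [coords_mutate]
    exact algebraicIndependent_mutVar ht.algebraicIndependent (ht.col_self k) (ht.col_ne_zero k)
  col_independent c hc := by
    have hcol (j : Fin n) (hj : j ≠ k) (l : Fin n ⊕ Fin m) (hl : l ≠ .inl k) :
        (t.mutate K k).col j l = t.col j l + max (t.B k j) 0 * t.col k l -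
          t.B k j * min (t.col k l) 0 := by
      rw [col_mutate_of_ne t hj, mutCol, if_neg hl]
      change _ + _ * max (_ * t.B k j) 0 = _
      generalize t.col k l = x
      generalize t.B k j = b
      rcases lt_trichotomy x 0 with hx | rfl | hx
      · rw [min_eq_left hx.le, Int.sign_eq_neg_one_of_neg hx]
        rcases le_total b 0 with hb | hb
        · rw [max_eq_right hb, max_eq_left (mul_nonneg_of_nonpos_of_nonpos hx.le hb)]; ring
        · rw [max_eq_left hb, max_eq_right (mul_nonpos_of_nonpos_of_nonneg hx.le hb)]; ring
      · simp
      · rw [min_eq_right hx.le, Int.sign_eq_one_of_pos hx]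
        rcases le_total b 0 with hb | hb
        · rw [max_eq_right hb, max_eq_right (mul_nonpos_of_nonneg_of_nonpos hx.le hb)]; ring
        · rw [max_eq_left hb, max_eq_left (mul_nonneg hx.le hb)]; ring
    have hkk : t.B k k = 0 := ht.col_self k
    -- Mutation negates row `k`, so this is the `k`-th coordinate of the relation. It kills the
    -- terms with `min (t.col k l) 0`, the only ones not linear in the old columns.
    have hrow : ∑ j, c j * t.B k j = 0 := by
      have := congrFun hc (.inl k)
      simp only [Finset.sum_apply, Pi.smul_apply, smul_eq_mul, Pi.zero_apply] at this
      rw [← neg_eq_zero, ← Finset.sum_neg_distrib, ← this]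
      refine Finset.sum_congr rfl fun j _ => ?_
      simp [col, SeedData.mutate, mutateMatrix]
    -- Coefficients of the same relation in terms of the old columns; the `-c k` comes from the sign
    -- change of column `k`.
    set e : Fin n → ℤ := Function.update c k (∑ j, c j * max (t.B k j) 0 - c k) with he
    have hsum (f : Fin n → ℤ) : ∑ j, e j * f j =
        ∑ j, c j * f j + (∑ j, c j * max (t.B k j) 0 - 2 * c k) * f k := by
      have hej (j : Fin n) : e j = c j + if j = k then ∑ j, c j * max (t.B k j) 0 - 2 * c k
          else 0 := by
        rcases eq_or_ne j k with rfl | hj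
        · rw [he, Function.update_self, if_pos rfl]
          ring
        · simp [he, hj]
      simp [hej, add_mul, Finset.sum_add_distrib]
    have he0 : e = 0 := by
      refine ht.col_independent e (funext fun l => ?_)
      simp only [Finset.sum_apply, Pi.smul_apply, smul_eq_mul, Pi.zero_apply]
      rw [hsum]
      rcases eq_or_ne l (.inl k) with rfl | hl
      · simpa [col, hkk] using hrow
      · have := congrFun hc l
        simp only [Finset.sum_apply, Pi.smul_apply, smul_eq_mul, Pi.zero_apply] at this
        have h2 : ∑ j, c j * (t.mutate K k).col j l =
            ∑ j, (c j * t.col j l + c j * max (t.B k j) 0 * t.col k l -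
              c j * t.B k j * min (t.col k l) 0) - 2 * c k * t.col k l := by
          have hcj (j : Fin n) : c j * (t.mutate K k).col j l =
              c j * t.col j l + c j * max (t.B k j) 0 * t.col k l -
              c j * t.B k j * min (t.col k l) 0 - if j = k then 2 * c k * t.col k l else 0 := by
            rcases eq_or_ne j k with rfl | hj
            · rw [col_mutate_self, hkk, if_pos rfl, max_self, Pi.neg_apply]
              ring
            · rw [hcol j hj l hl, if_neg hj]
              ring
          simp [hcj]
        rw [h2, Finset.sum_sub_distrib, Finset.sum_add_distrib, ← Finset.sum_mul,
          ← Finset.sum_mul, hrow] at this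
        linarith
    have hck : ∀ j, j ≠ k → c j = 0 := fun j hj => by
      have := congrFun he0 j
      rwa [he, Function.update_of_ne hj] at this
    have h3 := congrFun he0 k
    rw [he, Function.update_self, Finset.sum_eq_single k (fun j _ hj => by simp [hck j hj])
      (by simp), hkk] at h3
    ext j
    rcases eq_or_ne j k with rfl | hj
    · simpa using h3
    · exact hck j hj

end IsNondegenerate

/-! ### The upper cluster algebra as an upper bound. -/

section Pattern

variable [Algebra K F]

theorem coords_mutate_mutate [IsDomain K] {t : SeedData n (Trop m) F}
    (ht : t.IsNondegenerate K) (k : Fin n) :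
    ((t.mutate K k).mutate K k).coords K = t.coords K := by
  rw [coords_mutate, col_mutate_self, mutVar_neg, coords_mutate, mutVar, bin_mutVar (ht.col_self k),
    mutVar_self, div_div_cancel₀ (bin_ne_zero ht.algebraicIndependent (ht.col_ne_zero k))]
  simp [mutVar]

/-- Membership in the intersection of the Laurent rings of a seed and of its neighbours. -/
def MemUpperBound (K : Type*) [CommRing K] [Algebra (MonoidAlgebra K (Trop m)) F] [Algebra K F]
    (t : SeedData n (Trop m) F) (f : F) : Prop :=
  f ∈ laurent K (t.coords K) ∧ ∀ k, f ∈ laurent K ((t.mutate K k).coords K)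

/-- Mutating again at `k` returns to the old coordinates; every other direction is the two-direction
case, with signs from skew-symmetrizability. -/
theorem MemUpperBound.mutate [IsDomain K] [UniqueFactorizationMonoid K]
    {t : SeedData n (Trop m) F} (ht : t.IsNondegenerate K) {f : F}
    (hf : t.MemUpperBound K f) (k : Fin n) : (t.mutate K k).MemUpperBound K f := by
  refine ⟨hf.2 k, fun i => ?_⟩
  rcases eq_or_ne i k with rfl | hik
  · rw [coords_mutate_mutate ht]
    exact hf.1
  have h1 := hf.2 k
  have h2 := hf.2 i
  rw [coords_mutate] at h1 h2
  rw [coords_mutate, coords_mutate, col_mutate_of_ne t hik]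
  refine mem_laurent_mutVar_mutVar ht.algebraicIndependent (by simpa using hik) (ht.col_self k)
    (ht.col_self i) ?_ (fun a b hab => ?_) h1 h2
  · obtain ⟨d, hd, h⟩ := isSkewSymmetrizable_iff.1 ht.skew
    have := h i k
    simp only [col, Sum.elim_inl]
    rcases lt_trichotomy (t.B k i) 0 with h0 | h0 | h0
    · exact .inr (.inl ⟨h0, by nlinarith [hd i, hd k, mul_neg_of_pos_of_neg (hd k) h0]⟩)
    · rw [h0] at this
      exact .inr (.inr ⟨h0, by simpa [(hd i).ne'] using this⟩)
    · exact .inl ⟨h0, by nlinarith [hd i, hd k, mul_pos (hd k) h0]⟩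
  · have := ht.col_independent (Pi.single k a + Pi.single i b) (by
      simpa [add_smul, Finset.sum_add_distrib, Pi.single_apply, ite_smul] using hab)
    have ha := congrFun this k
    have hb := congrFun this i
    simp [hik, hik.symm] at ha hb
    exact ⟨ha, hb⟩

variable [IsScalarTower K (MonoidAlgebra K (Trop m)) F]

theorem mem_laurentRing_iff {t : SeedData n (Trop m) F} {f : F} :
    f ∈ t.laurentRing K ↔ f ∈ laurent K (t.coords K) := by
  have hZ : ∀ r : MonoidAlgebra K (Trop m),
      algebraMap (MonoidAlgebra K (Trop m)) F r ∈ laurent K (t.coords K) := by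
    intro r
    induction r using MonoidAlgebra.induction_linear with
    | zero => simp
    | add a b ha hb => rw [map_add]; exact add_mem ha hb
    | single p a =>
      have : (MonoidAlgebra.single p a : MonoidAlgebra K (Trop m)) =
          a • MonoidAlgebra.of K (Trop m) p := by simp
      rw [this, Algebra.algebraMap_eq_smul_one, smul_assoc, ← Algebra.algebraMap_eq_smul_one,
        algebraMap_of_trop]
      exact Subalgebra.smul_mem _ (prod_mem fun i _ => zpow_mem_of_inv_mem
        (mem_laurent (y := t.coords K) (.inr i)) (inv_mem_laurent (y := t.coords K) (.inr i)) _) _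
  constructor
  · intro hf
    induction hf using Algebra.adjoin_induction with
    | mem x hx =>
      rcases hx with ⟨j, rfl⟩ | ⟨j, rfl⟩
      · exact mem_laurent (y := t.coords K) (.inl j)
      · exact inv_mem_laurent (y := t.coords K) (.inl j)
    | algebraMap r => exact hZ r
    | add a b _ _ ha hb => exact add_mem ha hb
    | mul a b _ _ ha hb => exact mul_mem ha hb
  · intro hf
    induction hf using Algebra.adjoin_induction with
    | mem x hx =>
      rcases hx with ⟨j | i, rfl⟩ | ⟨j | i, rfl⟩
      · exact Algebra.subset_adjoin (Or.inl ⟨j, rfl⟩)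
      · exact Subalgebra.algebraMap_mem _ _
      · exact Algebra.subset_adjoin (Or.inr ⟨j, rfl⟩)
      · have : (t.coords K (.inr i))⁻¹ = algebraMap (MonoidAlgebra K (Trop m)) F
            (MonoidAlgebra.of K (Trop m) (Trop.gen i)⁻¹) := by
          refine inv_eq_of_mul_eq_one_right ?_
          simp only [coords, Sum.elim_inr]
          rw [← map_mul, ← map_mul, mul_inv_cancel, map_one, map_one]
        simp only [this]
        exact Subalgebra.algebraMap_mem _ _
    | algebraMap r =>
      rw [IsScalarTower.algebraMap_apply K (MonoidAlgebra K (Trop m)) F]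
      exact Subalgebra.algebraMap_mem _ _
    | add a b _ _ ha hb => exact add_mem ha hb
    | mul a b _ _ ha hb => exact mul_mem ha hb

variable [IsDomain K] {t : SeedData n (Trop m) F}

/-- The upper cluster algebra of a seed of full rank is its upper bound. -/
theorem mem_upperClusterAlgebra_iff [UniqueFactorizationMonoid K] (ht : t.IsNondegenerate K)
    {f : F} : f ∈ t.upperClusterAlgebra K ↔ t.MemUpperBound K f := by
  simp only [upperClusterAlgebra, Algebra.mem_iInf, mem_laurentRing_iff]
  constructor
  · exact fun h => ⟨h t ⟨[], rfl⟩, fun k => h _ ⟨[k], rfl⟩⟩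
  · rintro h _ ⟨w, rfl⟩
    have key : ∀ (w : List (Fin n)) (s : SeedData n (Trop m) F), s.IsNondegenerate K →
        s.MemUpperBound K f → f ∈ laurent K ((w.foldl (fun s k => s.mutate K k) s).coords K) := by
      intro w
      induction w with
      | nil => exact fun s _ h => h.1
      | cons k w ih => exact fun s hs h => ih _ (hs.mutate k) (h.mutate hs k)
    exact key w t ht h

end Pattern

section Initial

variable [Algebra K F] [IsScalarTower K (MonoidAlgebra K (Trop m)) F]

/-- The coefficients of a polynomial can be read off from its value in the group ring at nonnegative
exponent vectors. -/
theorem algebraicIndependent_gen (K : Type*) [CommRing K] (m : ℕ) : AlgebraicIndependent K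
    fun i : Fin m => MonoidAlgebra.of K (Trop m) (Trop.gen i) := by
  have key (p : MvPolynomial (Fin m) K) (s : Fin m →₀ ℕ) :
      (MvPolynomial.aeval (fun i : Fin m => MonoidAlgebra.of K (Trop m) (Trop.gen i)) p).coeff
        (Multiplicative.ofAdd fun i => (s i : ℤ)) = p.coeff s := by
    induction p using MvPolynomial.induction_on' with
    | monomial u a =>
      have h1 : ∏ i, Trop.gen i ^ u i = Multiplicative.ofAdd fun i => (u i : ℤ) := by
        rw [Trop.eq_prod_gen (Multiplicative.ofAdd fun i => (u i : ℤ))]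
        simp
      rw [MvPolynomial.aeval_monomial, Finsupp.prod_fintype _ _ (by simp)]
      simp only [← map_pow, ← map_prod, h1, MvPolynomial.coeff_monomial]
      simp [Finsupp.single_apply, funext_iff, Finsupp.ext_iff]
    | add p q hp hq =>
      rw [map_add, MonoidAlgebra.coeff_add, Finsupp.add_apply, hp, hq, MvPolynomial.coeff_add]
  rw [algebraicIndependent_iff]
  intro p hp
  ext s
  rw [← key, hp]
  simp

theorem IsSeed.isNondegenerate {t : SeedData n (Trop m) F} (ht : t.IsSeed K)
    (hrank : t.IsFullRank) : t.IsNondegenerate K where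
  skew := ht.skew
  algebraicIndependent := (algebraicIndependent_gen K m).sumElim_comp ht.algebraicIndependent
  col_independent c hc := by
    set M := t.extendedMatrix.map (Int.cast : ℤ → ℚ) with hM
    have hker : M.mulVecLin.ker = ⊥ := by
      have h1 := M.mulVecLin.finrank_range_add_finrank_ker
      rw [← Matrix.rank, show M.rank = n from hrank, Module.finrank_fin_fun] at h1
      exact Submodule.finrank_eq_zero.1 (by omega)
    have h2 : M.mulVecLin (fun j => (c j : ℚ)) = 0 := by
      ext l
      have h3 := congrArg (Int.cast : ℤ → ℚ) (congrFun hc l)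
      simp only [Finset.sum_apply, Pi.smul_apply, smul_eq_mul, Pi.zero_apply, Int.cast_sum,
        Int.cast_mul, Int.cast_zero] at h3
      rw [Matrix.mulVecLin_apply, Matrix.mulVec, dotProduct, Pi.zero_apply, ← h3]
      refine Finset.sum_congr rfl fun j _ => ?_
      rw [mul_comm]
      rcases l with l | l <;> rfl
    have h4 := (LinearMap.ker_eq_bot'.1 hker) _ h2
    ext j
    simpa using congrFun h4 j

end Initial

end Coordinates

end SeedData
end ClusterAlgebra

/-! ### Divisibility, the valuation pairing, and factors of binomials. -/

namespace ClusterAlgebra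

theorem mk_dvd_mk_iff {R F : Type*} [CommRing R] [Field F] [Algebra R F] {L : Subalgebra R F}
    {a b : F} (ha : a ∈ L) (hb : b ∈ L) (h0 : a ≠ 0) :
    (⟨a, ha⟩ : L) ∣ ⟨b, hb⟩ ↔ b / a ∈ L := by
  constructor
  · rintro ⟨c, hc⟩
    have : b = a * c := congrArg Subtype.val hc
    rw [this, mul_div_cancel_left₀ _ h0]
    exact c.2
  · intro h
    exact ⟨⟨_, h⟩, Subtype.ext (mul_div_cancel₀ b h0).symm⟩

theorem isUnit_mk_iff {R F : Type*} [CommRing R] [Field F] [Algebra R F] {L : Subalgebra R F}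
    {a : F} (ha : a ∈ L) (h0 : a ≠ 0) : IsUnit (⟨a, ha⟩ : L) ↔ a⁻¹ ∈ L := by
  rw [isUnit_iff_dvd_one, ← one_div]
  exact mk_dvd_mk_iff ha (one_mem L) h0

theorem inv_mem_of_zpow_mem {R F : Type*} [CommRing R] [Field F] [Algebra R F]
    {L : Subalgebra R F} {a : F} (ha : a ∈ L) (h0 : a ≠ 0) {n : ℤ} (hn : n < 0)
    (h : a ^ n ∈ L) : a⁻¹ ∈ L := by
  obtain ⟨k, hk⟩ : ∃ k : ℕ, n = -((k : ℤ) + 1) := ⟨(-n - 1).toNat, by omega⟩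
  have : a⁻¹ = a ^ k * a ^ n := by
    rw [hk, ← zpow_natCast, ← zpow_add₀ h0, ← zpow_neg_one]
    congr 1
    ring
  rw [this]
  exact mul_mem (pow_mem ha k) h

theorem valuationPairing_eq_emultiplicity {R F : Type*} [CommRing R] [Field F] [Algebra R F]
    {U : Subalgebra R F} {a : F} (ha : a ∈ U) (h0 : a ≠ 0) (M : U) :
    valuationPairing U a M = emultiplicity ⟨a, ha⟩ M := by
  have key (s : ℕ) : (M : F) / a ^ s ∈ U ↔ (⟨a, ha⟩ : U) ^ s ∣ M :=
    (mk_dvd_mk_iff (pow_mem ha s) M.2 (pow_ne_zero s h0)).symm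
  refine le_antisymm (sSup_le ?_) (ENat.forall_natCast_le_iff_le.1 fun s hs => le_sSup ?_)
  · rintro _ ⟨s, hs, rfl⟩
    exact le_emultiplicity_of_pow_dvd ((key s).1 hs)
  · exact ⟨s, (key s).2 (pow_dvd_of_le_emultiplicity hs), rfl⟩

/-- Non-divisibility means multiplicity zero, so additivity says precisely that a product of two
non-multiples is a non-multiple. -/
theorem prime_iff_valuationPairing_mul {R F : Type*} [CommRing R] [Field F] [Algebra R F]
    {U : Subalgebra R F} {a : F} (ha : a ∈ U) (h0 : a ≠ 0) (hinv : a⁻¹ ∉ U) :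
    Prime (⟨a, ha⟩ : U) ↔ ∀ M L : U, M ≠ 0 → L ≠ 0 →
      valuationPairing U a (M * L) = valuationPairing U a M + valuationPairing U a L := by
  simp only [valuationPairing_eq_emultiplicity ha h0]
  refine ⟨fun h M L _ _ => emultiplicity_mul h, fun h => ⟨fun h => h0 (congrArg Subtype.val h),
    fun h => hinv ((isUnit_mk_iff ha h0).1 h), fun M L hd => ?_⟩⟩
  rcases eq_or_ne M 0 with rfl | hM
  · exact .inl (dvd_zero _)
  rcases eq_or_ne L 0 with rfl | hL
  · exact .inr (dvd_zero _)
  by_contra! hc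
  have := h M L hM hL
  rw [emultiplicity_eq_zero.2 hc.1, emultiplicity_eq_zero.2 hc.2, add_zero,
    emultiplicity_eq_zero] at this
  exact this hd

section Binomial

variable {K σ F : Type*} [CommRing K] [Field F] [Algebra K F] {y : σ → F} [Fintype σ]

/-- A polynomial divisor of an exchange binomial that becomes invertible in the Laurent ring is
a unit of the base ring. -/
theorem exists_eq_algebraMap_of_mul_eq_bin [IsDomain K] (hy : AlgebraicIndependent K y)
    {v : σ → ℤ} (hv : v ≠ 0) {f g : F} (hf : f ∈ Algebra.adjoin K (Set.range y))
    (hg : g ∈ Algebra.adjoin K (Set.range y)) (hfg : f * g = bin y v)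
    (hg' : g⁻¹ ∈ laurent K y) : ∃ u : K, IsUnit u ∧ g = algebraMap K F u := by
  classical
  rw [Algebra.adjoin_range_eq_range_aeval] at hf hg
  obtain ⟨p, rfl⟩ := hf
  obtain ⟨q, rfl⟩ := hg
  simp only [AlgHom.toRingHom_eq_coe, RingHom.coe_coe] at *
  have hq0 : MvPolynomial.aeval y q ≠ 0 := right_ne_zero_of_mul (hfg ▸ bin_ne_zero hy hv)
  obtain ⟨e, u, hu, rfl⟩ := exists_eq_monomial_of_mul_eq_one hy hg' (mul_inv_cancel₀ hq0)
  let a (w : σ → ℤ) : σ →₀ ℕ := Finsupp.equivFunOnFinite.symm fun l => (w l).toNat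
  have ha (w : σ → ℤ) : MvPolynomial.aeval y (MvPolynomial.monomial (a w) (1 : K)) =
      mon y fun l => max (w l) 0 := by
    rw [MvPolynomial.aeval_monomial, Finsupp.prod_fintype _ _ (by simp), map_one, one_mul]
    refine Finset.prod_congr rfl fun l _ => ?_
    rw [← zpow_natCast]
    congr 1
    simp [a]
  have hpq : p * MvPolynomial.monomial e u =
      MvPolynomial.monomial (a v) 1 + MvPolynomial.monomial (a (-v)) 1 := by
    apply hy
    rw [map_mul, hfg, map_add, ha, ha]
    rfl
  have hne : a v ≠ a (-v) := fun h => hv (funext fun l => by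
    have := DFunLike.congr_fun h l
    simp only [a, Finsupp.equivFunOnFinite_symm_apply_apply, Pi.neg_apply] at this
    simp only [Pi.zero_apply]
    omega)
  -- Each variable is absent from at least one of the two terms, so none divides the binomial.
  have he : e = 0 := by
    ext l
    by_contra hl
    obtain ⟨r, hr⟩ : MvPolynomial.X l ∣
        (MvPolynomial.monomial (a v) 1 + MvPolynomial.monomial (a (-v)) 1 : MvPolynomial σ K) := by
      rw [← hpq]
      exact (MvPolynomial.X_dvd_monomial.2 (.inr hl)).mul_left p
    have hcoeff (w : σ → ℤ) (hw : w l ≤ 0) : MvPolynomial.coeff (a w)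
        (MvPolynomial.monomial (a v) 1 + MvPolynomial.monomial (a (-v)) 1 : MvPolynomial σ K)
          = 0 := by
      rw [hr, MvPolynomial.coeff_X_mul', if_neg (by simp [a, hw])]
    rcases le_total (v l) 0 with h | h
    · simpa [MvPolynomial.coeff_add, MvPolynomial.coeff_monomial, hne.symm] using hcoeff v h
    · simpa [MvPolynomial.coeff_add, MvPolynomial.coeff_monomial, hne] using
        hcoeff (-v) (by simpa using h)
  subst he
  exact ⟨u, hu, by simp⟩

/-- A prime polynomial that is not invertible in the Laurent ring is prime there. -/
theorem prime_mk_of_prime_aeval [Nontrivial K] (hy : AlgebraicIndependent K y)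
    {p : MvPolynomial σ K} (hp : Prime p) {f : F} (hf : MvPolynomial.aeval y p = f)
    (hL : f ∈ laurent K y) (hinv : f⁻¹ ∉ laurent K y) : Prime (⟨f, hL⟩ : laurent K y) := by
  have hf0 : f ≠ 0 := fun h => hinv (by rw [h, inv_zero]; exact zero_mem _)
  have := isLocalization_laurent hy
  have h1 : (IsLocalization.toLocalizationMap
      (Submonoid.powers (∏ i, MvPolynomial.X i : MvPolynomial σ K)) (laurent K y)) p =
      ⟨f, hL⟩ := Subtype.ext ((coe_polyToLaurent p).trans hf)
  rw [← h1]
  refine Submonoid.LocalizationMap.map_prime _ hp ?_ ?_ <;> rw [h1]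
  · exact fun h => hf0 (congrArg Subtype.val h)
  · rwa [isUnit_mk_iff hL hf0]

end Binomial

/-! ### Initial cluster variables and exchange binomials. -/

namespace SeedData

variable {K : Type*} [CommRing K] {n m : ℕ} {F : Type*} [Field F]
  [Algebra (MonoidAlgebra K (Trop m)) F]

theorem coords_mutate_self (t : SeedData n (Trop m) F) (k : Fin n) :
    (t.mutate K k).coords K (.inl k) = bin (t.coords K) (t.col k) / t.A k := by
  rw [coords_mutate, mutVar_self]; rfl

theorem coords_mutate_of_ne (t : SeedData n (Trop m) F) {k : Fin n} {l : Fin n ⊕ Fin m}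
    (hl : l ≠ .inl k) :
    (t.mutate K k).coords K l = t.coords K l := by
  rw [coords_mutate, mutVar_of_ne hl]

variable [Algebra K F]

section Omit

variable [IsScalarTower K (MonoidAlgebra K (Trop m)) F]

theorem mem_omitPolyRing_iff {t : SeedData n (Trop m) F} {k : Fin n} {f : F} :
    f ∈ t.omitPolyRing K k ↔ f ∈ Algebra.adjoin K (t.coords K '' {.inl k}ᶜ) := by
  constructor
  · intro hf
    induction hf using Algebra.adjoin_induction with
    | mem x hx =>
      obtain ⟨j, hj, rfl⟩ := hx
      exact Algebra.subset_adjoin ⟨.inl j, by simpa using hj, rfl⟩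
    | algebraMap r =>
      obtain ⟨r, hr⟩ := r
      change algebraMap (MonoidAlgebra K (Trop m)) F r ∈ _
      induction hr using Algebra.adjoin_induction with
      | mem x hx =>
        obtain ⟨i, rfl⟩ := hx
        exact Algebra.subset_adjoin ⟨.inr i, by simp, rfl⟩
      | algebraMap r =>
        rw [← IsScalarTower.algebraMap_apply]
        exact Subalgebra.algebraMap_mem _ _
      | add a b _ _ ha hb => rw [map_add]; exact add_mem ha hb
      | mul a b _ _ ha hb => rw [map_mul]; exact mul_mem ha hb
    | add a b _ _ ha hb => exact add_mem ha hb
    | mul a b _ _ ha hb => exact mul_mem ha hb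
  · intro hf
    have hc (r : coeffPolyRing K m) :
        algebraMap (MonoidAlgebra K (Trop m)) F r ∈ t.omitPolyRing K k :=
      Subalgebra.algebraMap_mem (t.omitPolyRing K k) r
    induction hf using Algebra.adjoin_induction with
    | mem x hx =>
      obtain ⟨j | i, hj, rfl⟩ := hx
      · exact Algebra.subset_adjoin ⟨j, by simpa using hj, rfl⟩
      · exact hc ⟨_, Algebra.subset_adjoin ⟨i, rfl⟩⟩
    | algebraMap r =>
      rw [IsScalarTower.algebraMap_apply K (MonoidAlgebra K (Trop m)) F]
      exact hc (algebraMap K _ r)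
    | add a b _ _ ha hb => exact add_mem ha hb
    | mul a b _ _ ha hb => exact mul_mem ha hb

/-- Identifies the ring with a polynomial ring, factorial when `K` is, so that an irreducible
exchange binomial is prime. -/
theorem exists_omitPolyRing_equiv {t : SeedData n (Trop m) F}
    (hy : AlgebraicIndependent K (t.coords K)) (k : Fin n) :
    ∃ e : MvPolynomial ({.inl k}ᶜ : Set (Fin n ⊕ Fin m)) K ≃+* t.omitPolyRing K k,
      ∀ p, (e p : F) =
        MvPolynomial.aeval (fun l : ({.inl k}ᶜ : Set (Fin n ⊕ Fin m)) => t.coords K l) p := by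
  have hx := hy.comp ((↑) : ({.inl k}ᶜ : Set (Fin n ⊕ Fin m)) → _) Subtype.val_injective
  have hrange : Set.range (t.coords K ∘ ((↑) : ({.inl k}ᶜ : Set (Fin n ⊕ Fin m)) → _)) =
      t.coords K '' {.inl k}ᶜ := by rw [Set.range_comp, Subtype.range_coe]
  have hmem (f : F) : f ∈ (MvPolynomial.aeval (R := K) (t.coords K ∘
      ((↑) : ({.inl k}ᶜ : Set (Fin n ⊕ Fin m)) → _))).range ↔ f ∈ t.omitPolyRing K k := by
    rw [mem_omitPolyRing_iff, ← hrange, Algebra.adjoin_range_eq_range_aeval]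
  let g : MvPolynomial ({.inl k}ᶜ : Set (Fin n ⊕ Fin m)) K →+* t.omitPolyRing K k :=
    RingHom.codRestrict (MvPolynomial.aeval (R := K) (t.coords K ∘ Subtype.val)).toRingHom _
      fun p => (hmem _).1 ⟨p, rfl⟩
  refine ⟨RingEquiv.ofBijective g ⟨fun p q h => hx (congrArg Subtype.val h), fun f => ?_⟩,
    fun p => rfl⟩
  obtain ⟨p, hp⟩ := (hmem f).2 f.2
  exact ⟨p, Subtype.ext hp⟩

end Omit

theorem inv_coords_mem_laurent_mutate (t : SeedData n (Trop m) F) {l : Fin n ⊕ Fin m} {k : Fin n}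
    (hl : l ≠ .inl k) :
    (t.coords K l)⁻¹ ∈ laurent K ((t.mutate K k).coords K) := by
  rw [← t.coords_mutate_of_ne hl]; exact inv_mem_laurent l

/-- `t.A k` is invertible in every other Laurent ring of the bound, so only direction `k` imposes a
condition. -/
theorem MemUpperBound.div {t : SeedData n (Trop m) F} {k : Fin n} {f : F}
    (hf : t.MemUpperBound K f)
    (h : f / t.A k ∈ laurent K ((t.mutate K k).coords K)) : t.MemUpperBound K (f / t.A k) := by
  refine ⟨?_, fun j => ?_⟩
  · rw [div_eq_mul_inv]
    exact mul_mem hf.1 (inv_mem_laurent (y := t.coords K) (.inl k))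
  · rcases eq_or_ne k j with rfl | hj
    · exact h
    · rw [div_eq_mul_inv]
      exact mul_mem (hf.2 j)
        (t.inv_coords_mem_laurent_mutate (l := .inl k) (by simpa using hj))

namespace IsNondegenerate

theorem bin_coords_mutate {t : SeedData n (Trop m) F} (ht : t.IsNondegenerate K) (k : Fin n) :
    bin ((t.mutate K k).coords K) (t.col k) = bin (t.coords K) (t.col k) := by
  rw [coords_mutate, bin_mutVar (ht.col_self k)]

theorem exchangeBinomial_mem [IsScalarTower K (MonoidAlgebra K (Trop m)) F]
    {t : SeedData n (Trop m) F} (ht : t.IsNondegenerate K) (k : Fin n) :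
    t.exchangeBinomial K k ∈ t.omitPolyRing K k := by
  rw [mem_omitPolyRing_iff, exchangeBinomial_eq_bin]
  exact bin_mem_adjoin_image (ht.col_self k)

theorem bin_mem_laurent_mutate {t : SeedData n (Trop m) F} (ht : t.IsNondegenerate K) (k : Fin n) :
   
    bin (t.coords K) (t.col k) ∈ laurent K ((t.mutate K k).coords K) := by
  rw [← ht.bin_coords_mutate]; exact bin_mem _

variable [IsDomain K] {t : SeedData n (Trop m) F} (ht : t.IsNondegenerate K)

include ht

theorem A_ne_zero (k : Fin n) : t.A k ≠ 0 := ht.algebraicIndependent.ne_zero (.inl k)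

theorem bin_ne_zero (k : Fin n) : bin (t.coords K) (t.col k) ≠ 0 :=
  ClusterAlgebra.bin_ne_zero ht.algebraicIndependent (ht.col_ne_zero k)

theorem inv_bin_not_mem (k : Fin n) :
    (bin (t.coords K) (t.col k))⁻¹ ∉ laurent K ((t.mutate K k).coords K) := by
  rw [← ht.bin_coords_mutate]
  exact ClusterAlgebra.inv_bin_not_mem (ht.mutate k).algebraicIndependent (ht.col_ne_zero k)

theorem A_eq_bin_mul (k : Fin n) :
    t.A k = bin (t.coords K) (t.col k) * ((t.mutate K k).coords K (.inl k))⁻¹ := by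
  rw [coords_mutate_self, inv_div, mul_div_cancel₀ _ (ht.bin_ne_zero k)]

theorem coords_mem_laurent_mutate (l : Fin n ⊕ Fin m) (k : Fin n) :
    t.coords K l ∈ laurent K ((t.mutate K k).coords K) := by
  rcases eq_or_ne l (.inl k) with rfl | hl
  · change t.A k ∈ _
    rw [ht.A_eq_bin_mul]
    exact mul_mem (ht.bin_mem_laurent_mutate k) (inv_mem_laurent _)
  · rw [← t.coords_mutate_of_ne hl]; exact mem_laurent l

theorem inv_A_not_mem (k : Fin n) : (t.A k)⁻¹ ∉ laurent K ((t.mutate K k).coords K) := by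
  intro h
  refine ht.inv_bin_not_mem k ?_
  have h1 := inv_mem_laurent (K := K) (y := (t.mutate K k).coords K) (.inl k)
  have h2 : (bin (t.coords K) (t.col k))⁻¹ =
      (t.A k)⁻¹ * ((t.mutate K k).coords K (.inl k))⁻¹ := by
    rw [coords_mutate_self]
    have := ht.A_ne_zero k
    field_simp
  rw [h2]
  exact mul_mem h h1

theorem memUpperBound_coords (l : Fin n ⊕ Fin m) : t.MemUpperBound K (t.coords K l) :=
  ⟨mem_laurent l, ht.coords_mem_laurent_mutate l⟩

theorem memUpperBound_of_mem_adjoin {S : Set (Fin n ⊕ Fin m)} {f : F}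
    (hf : f ∈ Algebra.adjoin K (t.coords K '' S)) : t.MemUpperBound K f := by
  refine ⟨Algebra.adjoin_le ?_ hf, fun k => Algebra.adjoin_le ?_ hf⟩
  · rintro _ ⟨l, _, rfl⟩
    exact mem_laurent l
  · rintro _ ⟨l, _, rfl⟩
    exact ht.coords_mem_laurent_mutate l k

theorem memUpperBound_mutate (k : Fin n) :
    t.MemUpperBound K ((t.mutate K k).coords K (.inl k)) := by
  have hb : t.MemUpperBound K (bin (t.coords K) (t.col k)) :=
    ht.memUpperBound_of_mem_adjoin (bin_mem_adjoin_image (ht.col_self k))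
  refine ⟨?_, fun j => ?_⟩
  · rw [coords_mutate_self, div_eq_mul_inv]
    exact mul_mem hb.1 (inv_mem_laurent (y := t.coords K) (.inl k))
  · rcases eq_or_ne k j with rfl | hj
    · exact mem_laurent _
    · rw [coords_mutate_self, div_eq_mul_inv]
      exact mul_mem (hb.2 j)
        (t.inv_coords_mem_laurent_mutate (l := .inl k) (by simpa using hj))

variable [IsScalarTower K (MonoidAlgebra K (Trop m)) F]

variable [UniqueFactorizationMonoid K]

theorem A_mem (k : Fin n) : t.A k ∈ t.upperClusterAlgebra K :=
  (mem_upperClusterAlgebra_iff ht).2 (ht.memUpperBound_coords (.inl k))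

theorem inv_A_not_mem_upperClusterAlgebra (k : Fin n) : (t.A k)⁻¹ ∉ t.upperClusterAlgebra K :=
  fun h => ht.inv_A_not_mem k (((mem_upperClusterAlgebra_iff ht).1 h).2 k)

/-- The binomial is prime in the polynomial ring, stays prime after adjoining the new variable and
localizing, and is associated to `t.A k` in the Laurent ring of `μ_k t`, the only one that decides
divisibility by `t.A k`. -/
theorem prime_A_of_irreducible {k : Fin n}
    (h : Irreducible (⟨t.exchangeBinomial K k, ht.exchangeBinomial_mem k⟩ : t.omitPolyRing K k)) :
    Prime (⟨t.A k, ht.A_mem k⟩ : t.upperClusterAlgebra K) := by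
  have hA := ht.A_ne_zero k
  obtain ⟨e, he⟩ := exists_omitPolyRing_equiv ht.algebraicIndependent k
  obtain ⟨p, hp⟩ := e.surjective ⟨_, ht.exchangeBinomial_mem k⟩
  rw [← hp, MulEquiv.irreducible_iff] at h
  have hev : MvPolynomial.aeval ((t.mutate K k).coords K) (MvPolynomial.rename (↑) p) =
      bin (t.coords K) (t.col k) := by
    rw [MvPolynomial.aeval_rename, ← exchangeBinomial_eq_bin]
    have : t.exchangeBinomial K k = _ := (congrArg Subtype.val hp).symm.trans (he p)
    rw [this]
    congr 2
    ext l
    exact t.coords_mutate_of_ne l.2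
  have hprime := prime_mk_of_prime_aeval (ht.mutate k).algebraicIndependent
    ((MvPolynomial.prime_rename_iff _).2 h.prime) hev (ht.bin_mem_laurent_mutate k)
    (ht.inv_bin_not_mem k)
  refine ⟨fun h => hA (congrArg Subtype.val h),
    fun h => ht.inv_A_not_mem_upperClusterAlgebra k ((isUnit_mk_iff _ hA).1 h), ?_⟩
  have hdiv (f : F) : f / t.A k =
      f / bin (t.coords K) (t.col k) * (t.mutate K k).coords K (.inl k) := by
    rw [coords_mutate_self]
    have := ht.bin_ne_zero k
    field_simp
  have hdiv' (f : F) : f / bin (t.coords K) (t.col k) =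
      f / t.A k * ((t.mutate K k).coords K (.inl k))⁻¹ := by
    rw [coords_mutate_self]
    have := ht.bin_ne_zero k
    field_simp
  have key {f : F} (hf : f ∈ t.upperClusterAlgebra K)
      (h : f / bin (t.coords K) (t.col k) ∈ laurent K ((t.mutate K k).coords K)) :
      f / t.A k ∈ t.upperClusterAlgebra K := by
    rw [mem_upperClusterAlgebra_iff ht] at hf ⊢
    refine hf.div ?_
    rw [hdiv]
    exact mul_mem h (mem_laurent _)
  rintro ⟨a, ha⟩ ⟨b, hb⟩ hab
  rw [MulMemClass.mk_mul_mk, mk_dvd_mk_iff _ _ hA, mem_upperClusterAlgebra_iff ht] at hab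
  rw [mk_dvd_mk_iff _ _ hA, mk_dvd_mk_iff _ _ hA]
  have haL := ((mem_upperClusterAlgebra_iff ht).1 ha).2 k
  have hbL := ((mem_upperClusterAlgebra_iff ht).1 hb).2 k
  have hdvd : (⟨_, ht.bin_mem_laurent_mutate k⟩ : laurent K ((t.mutate K k).coords K)) ∣
      ⟨a, haL⟩ * ⟨b, hbL⟩ := by
    rw [MulMemClass.mk_mul_mk, mk_dvd_mk_iff _ _ (ht.bin_ne_zero k), hdiv']
    exact mul_mem (hab.2 k) (inv_mem_laurent _)
  refine (hprime.dvd_or_dvd hdvd).imp (fun h => key ha ?_) (fun h => key hb ?_)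
  · exact (mk_dvd_mk_iff _ _ (ht.bin_ne_zero k)).1 h
  · exact (mk_dvd_mk_iff _ _ (ht.bin_ne_zero k)).1 h

theorem irreducible_of_prime_A {k : Fin n}
    (h : Prime (⟨t.A k, ht.A_mem k⟩ : t.upperClusterAlgebra K)) :
    Irreducible (⟨t.exchangeBinomial K k, ht.exchangeBinomial_mem k⟩ : t.omitPolyRing K k) := by
  have hA := ht.A_ne_zero k
  have hb0 := ht.bin_ne_zero k
  have himg : (t.mutate K k).coords K '' {.inl k}ᶜ = t.coords K '' {.inl k}ᶜ :=
    Set.image_congr fun l hl => t.coords_mutate_of_ne hl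
  have homit {f : F} (hf : f ∈ t.omitPolyRing K k) :
      f ∈ Algebra.adjoin K (Set.range ((t.mutate K k).coords K)) := by
    rw [mem_omitPolyRing_iff, ← himg] at hf
    exact Algebra.adjoin_mono (Set.image_subset_range _ _) hf
  have homitU {f : F} (hf : f ∈ t.omitPolyRing K k) : f ∈ t.upperClusterAlgebra K :=
    (mem_upperClusterAlgebra_iff ht).2 (ht.memUpperBound_of_mem_adjoin (mem_omitPolyRing_iff.1 hf))
  have hunit {f g : F} (hf : f ∈ t.omitPolyRing K k) (hg : g ∈ t.omitPolyRing K k)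
      (hfg : f * g = bin (t.coords K) (t.col k)) (hd : f / t.A k ∈ t.upperClusterAlgebra K) :
      IsUnit (⟨g, hg⟩ : t.omitPolyRing K k) := by
    have hf0 : f ≠ 0 := left_ne_zero_of_mul (hfg ▸ hb0)
    have hg0 : g ≠ 0 := right_ne_zero_of_mul (hfg ▸ hb0)
    have hg' : g⁻¹ ∈ laurent K ((t.mutate K k).coords K) := by
      -- From `f * g = A_k * A'_k`: once `A_k` divides `f`, the cofactor `g` is invertible in the
      -- Laurent ring of `μ_k t`.
      have : g⁻¹ = f / t.A k * ((t.mutate K k).coords K (.inl k))⁻¹ := by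
        rw [coords_mutate_self, ← hfg]
        field_simp
      rw [this]
      exact mul_mem (((mem_upperClusterAlgebra_iff ht).1 hd).2 k) (inv_mem_laurent _)
    obtain ⟨u, hu, rfl⟩ := exists_eq_algebraMap_of_mul_eq_bin (ht.mutate k).algebraicIndependent
      (ht.col_ne_zero k) (homit hf) (homit hg) (hfg.trans (ht.bin_coords_mutate k).symm) hg'
    obtain ⟨w, hw⟩ := hu.exists_right_inv
    have hw' : algebraMap K F w ∈ t.omitPolyRing K k :=
      mem_omitPolyRing_iff.2 (Subalgebra.algebraMap_mem _ w)
    exact IsUnit.of_mul_eq_one ⟨_, hw'⟩ (Subtype.ext (by simp [← map_mul, hw]))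
  refine ⟨fun hu => ?_, ?_⟩
  · rw [isUnit_mk_iff _ (by rw [exchangeBinomial_eq_bin]; exact hb0),
      exchangeBinomial_eq_bin] at hu
    exact ht.inv_bin_not_mem k (adjoin_le_laurent (homit hu))
  · rintro ⟨f, hf⟩ ⟨g, hg⟩ hfg
    have hfg' : f * g = bin (t.coords K) (t.col k) := by
      rw [← exchangeBinomial_eq_bin]; exact (congrArg Subtype.val hfg).symm
    have hdvd : (⟨t.A k, ht.A_mem k⟩ : t.upperClusterAlgebra K) ∣
        ⟨f, homitU hf⟩ * ⟨g, homitU hg⟩ := by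
      rw [MulMemClass.mk_mul_mk, mk_dvd_mk_iff _ _ hA, hfg', ← coords_mutate_self]
      exact (mem_upperClusterAlgebra_iff ht).2 (ht.memUpperBound_mutate k)
    rcases h.dvd_or_dvd hdvd with h | h
    · exact .inr (hunit hf hg hfg' ((mk_dvd_mk_iff _ _ hA).1 h))
    · exact .inl (hunit hg hf (by rw [mul_comm, hfg']) ((mk_dvd_mk_iff _ _ hA).1 h))

/-- The initial cluster variables are irreducible in the upper cluster algebra. -/
theorem irreducible_A (k : Fin n) :
    Irreducible (⟨t.A k, ht.A_mem k⟩ : t.upperClusterAlgebra K) := by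
  have hA := ht.A_ne_zero k
  have hy := ht.algebraicIndependent
  have hy0 : ∀ l, t.coords K l ≠ 0 := fun l => hy.ne_zero l
  refine ⟨fun h => ht.inv_A_not_mem_upperClusterAlgebra k ((isUnit_mk_iff _ hA).1 h), ?_⟩
  rintro ⟨a, ha⟩ ⟨b, hb⟩ hab
  have hab' : a * b = t.A k := (congrArg Subtype.val hab).symm
  have ha0 : a ≠ 0 := left_ne_zero_of_mul (hab' ▸ hA)
  have hb0 : b ≠ 0 := right_ne_zero_of_mul (hab' ▸ hA)
  have hainv : a⁻¹ = b * (t.A k)⁻¹ := by rw [← hab']; field_simp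
  have haB := (mem_upperClusterAlgebra_iff ht).1 ha
  have hbB := (mem_upperClusterAlgebra_iff ht).1 hb
  obtain ⟨κ, e, hκ, hae⟩ := exists_eq_mon_of_inv_mem hy ha0 haB.1 (by
    rw [hainv]; exact mul_mem hbB.1 (inv_mem_laurent (y := t.coords K) (.inl k)))
  obtain ⟨κ', hκ'⟩ := hκ.exists_right_inv
  have hκ1 : algebraMap K F κ * algebraMap K F κ' = 1 := by rw [← map_mul, hκ', map_one]
  have hκ0 : algebraMap K F κ ≠ 0 := left_ne_zero_of_mul_eq_one hκ1
  have hκi : (algebraMap K F κ)⁻¹ = algebraMap K F κ' := inv_eq_of_mul_eq_one_right hκ1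
  -- For `j ≠ k` the variable `A_k`, hence its factor `a`, is a unit in the Laurent ring of `μ_j t`.
  -- A nonzero exponent of `A_j` would make `A_j` invertible there.
  have hej (j : Fin n) (hj : j ≠ k) : e (.inl j) = 0 := by
    have hL := haB.2 j
    have hL' : a⁻¹ ∈ laurent K ((t.mutate K j).coords K) := by
      rw [hainv]
      exact mul_mem (hbB.2 j) (t.inv_coords_mem_laurent_mutate (l := .inl k)
        (by simpa using hj.symm))
    set r : Fin n ⊕ Fin m → ℤ := Function.update e (.inl j) 0 with hr
    have hrj : r (.inl j) = 0 := by simp [hr]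
    have her : e = r + Pi.single (.inl j) (e (.inl j)) := by
      ext l
      rcases eq_or_ne l (.inl j) with rfl | hl
      · simp [hr]
      · simp [hr, hl]
    have hrL (w : Fin n ⊕ Fin m → ℤ) (hw : w (.inl j) = 0) :
        mon (t.coords K) w ∈ laurent K ((t.mutate K j).coords K) := by
      rw [← mon_mutVar hw, ← coords_mutate]; exact mon_mem w
    have hr0 := mon_ne_zero hy0 r
    rw [her, mon_add hy0, mon_single] at hae
    have h1 : t.A j ^ e (.inl j) = a * algebraMap K F κ' * mon (t.coords K) (-r) := by
      rw [← hκi, mon_neg, hae]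
      change t.coords K (.inl j) ^ _ = _
      field_simp
    have h2 : t.A j ^ (-e (.inl j)) = a⁻¹ * algebraMap K F κ * mon (t.coords K) r := by
      rw [hae, zpow_neg]
      change (t.coords K (.inl j) ^ _)⁻¹ = _
      field_simp
    by_contra hne
    refine ht.inv_A_not_mem j ?_
    have hjL := ht.coords_mem_laurent_mutate (.inl j) j
    rcases lt_or_gt_of_ne hne with hlt | hlt
    · refine inv_mem_of_zpow_mem hjL (ht.A_ne_zero j) hlt ?_
      rw [h1]
      exact mul_mem (mul_mem hL (Subalgebra.algebraMap_mem _ _)) (hrL _ (by simp [hrj]))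
    · refine inv_mem_of_zpow_mem hjL (ht.A_ne_zero j) (neg_neg_of_pos hlt) ?_
      rw [h2]
      exact mul_mem (mul_mem hL' (Subalgebra.algebraMap_mem _ _)) (hrL _ hrj)
  set r : Fin n ⊕ Fin m → ℤ := Function.update e (.inl k) 0 with hr
  have hrj (j : Fin n) : r (.inl j) = 0 := by
    rcases eq_or_ne j k with rfl | hj
    · simp [hr]
    · rw [hr, Function.update_of_ne (by simpa using hj), hej j hj]
  have her : e = r + Pi.single (.inl k) (e (.inl k)) := by
    ext l
    rcases eq_or_ne l (.inl k) with rfl | hl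
    · simp [hr]
    · simp [hr, hl]
  have hrU (w : Fin n ⊕ Fin m → ℤ) (hw : ∀ j, w (.inl j) = 0) (c : K) :
      algebraMap K F c * mon (t.coords K) w ∈ t.upperClusterAlgebra K := by
    refine (mem_upperClusterAlgebra_iff ht).2
      ⟨mul_mem (Subalgebra.algebraMap_mem _ _) (mon_mem w), fun j =>
        mul_mem (Subalgebra.algebraMap_mem _ _) ?_⟩
    rw [← mon_mutVar (hw j), ← coords_mutate]
    exact mon_mem w
  set s := algebraMap K F κ * mon (t.coords K) r with hs
  have hs0 : s ≠ 0 := mul_ne_zero hκ0 (mon_ne_zero hy0 r)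
  have hsU : s ∈ t.upperClusterAlgebra K := hrU r hrj κ
  have hsU' : s⁻¹ ∈ t.upperClusterAlgebra K := by
    rw [hs, mul_inv, hκi, ← mon_neg]
    exact hrU (-r) (fun j => by simp [hrj]) κ'
  have has : a = s * t.A k ^ e (.inl k) := by
    have h1 : mon (t.coords K) e = mon (t.coords K) r * t.A k ^ e (.inl k) := by
      conv_lhs => rw [her]
      rw [mon_add hy0, mon_single]
      rfl
    rw [hae, h1, ← mul_assoc]
  have hbs : b = s⁻¹ * t.A k ^ (1 - e (.inl k)) := by
    have h1 : b = t.A k / a := by rw [← hab']; field_simp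
    rw [h1, has, zpow_sub₀ hA, zpow_one]
    field_simp
  have hkL := ht.coords_mem_laurent_mutate (.inl k) k
  have hmemk {f : F} (hf : f ∈ t.upperClusterAlgebra K) :=
    ((mem_upperClusterAlgebra_iff ht).1 hf).2 k
  rw [isUnit_mk_iff _ ha0, isUnit_mk_iff _ hb0]
  -- Up to the unit `s` of `𝒰`, the factors are powers of `A_k` with exponents summing to `1`. A
  -- negative exponent would make `A_k` invertible in the Laurent ring of `μ_k t`, so one factor is
  -- a unit.
  rcases lt_trichotomy (e (.inl k)) 0 with h | h | h
  · refine absurd (inv_mem_of_zpow_mem hkL hA h ?_) (ht.inv_A_not_mem k)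
    have : t.A k ^ e (.inl k) = s⁻¹ * a := by rw [has, inv_mul_cancel_left₀ hs0]
    change t.A k ^ _ ∈ _
    rw [this]
    exact mul_mem (hmemk hsU') (hmemk ha)
  · left
    rwa [has, h, zpow_zero, mul_one]
  · rcases (Int.add_one_le_iff.2 h).eq_or_lt with h1 | h1
    · right
      rw [hbs, ← h1]
      simpa using hsU
    · refine absurd (inv_mem_of_zpow_mem hkL hA (n := 1 - e (.inl k)) (by omega) ?_)
        (ht.inv_A_not_mem k)
      have : t.A k ^ (1 - e (.inl k)) = s * b := by rw [hbs, mul_inv_cancel_left₀ hs0]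
      change t.A k ^ _ ∈ _
      rw [this]
      exact mul_mem (hmemk hsU) (hmemk hb)

/-- If the initial cluster variables are prime, the upper cluster algebra is factorial. -/
theorem uniqueFactorizationMonoid_of_prime_A
    (h : ∀ k, Prime (⟨t.A k, ht.A_mem k⟩ : t.upperClusterAlgebra K)) :
    UniqueFactorizationMonoid (t.upperClusterAlgebra K) := by
  have hy0 : ∀ l, t.coords K l ≠ 0 := fun l => ht.algebraicIndependent.ne_zero l
  have := uniqueFactorizationMonoid_laurent ht.algebraicIndependent
  let incl (L : Subalgebra K F) (hL : ∀ f ∈ t.upperClusterAlgebra K, f ∈ L) :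
      t.upperClusterAlgebra K →+* L :=
    (algebraMap (t.upperClusterAlgebra K) F).codRestrict L fun f => hL f f.2
  have hinj (L) (hL) : Function.Injective (incl L hL) := fun a b hab => Subtype.ext (by
    have h : (incl L hL a : F) = incl L hL b := congrArg Subtype.val hab
    exact h)
  have hL : ∀ f ∈ t.upperClusterAlgebra K, f ∈ laurent K (t.coords K) :=
    fun f hf => ((mem_upperClusterAlgebra_iff ht).1 hf).1
  have hLk (k : Fin n) : ∀ f ∈ t.upperClusterAlgebra K, f ∈ laurent K ((t.mutate K k).coords K) :=
    fun f hf => ((mem_upperClusterAlgebra_iff ht).1 hf).2 k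
  refine uniqueFactorizationMonoid_of_inverting_primes
    (incl (laurent K (t.coords K)) hL) (hinj _ hL) h (fun k => ?_) (fun k a ha => ?_)
    (fun s => ?_)
  · exact (isUnit_mk_iff (mem_laurent (y := t.coords K) (.inl k)) (ht.A_ne_zero k)).2
      (inv_mem_laurent (y := t.coords K) (.inl k))
  -- Finite multiplicity is inherited from the factorial Laurent ring of `μ_k t`, where `A_k` is not
  -- a unit.
  · have := uniqueFactorizationMonoid_laurent (ht.mutate k).algebraicIndependent
    let j := incl _ (hLk k)
    have hja : j a ≠ 0 := (map_ne_zero_iff j (hinj _ (hLk k))).2 ha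
    have hnu : ¬ IsUnit (j ⟨t.A k, ht.A_mem k⟩) := fun hu => ht.inv_A_not_mem k
      ((isUnit_mk_iff (ht.coords_mem_laurent_mutate (.inl k) k) (ht.A_ne_zero k)).1 hu)
    obtain ⟨N, hN⟩ := FiniteMultiplicity.of_not_isUnit hnu hja
    exact ⟨N, fun hd => hN (by simpa only [map_pow] using map_dvd j hd)⟩
  · have hU {f : F} : f ∈ (t.upperClusterAlgebra K).restrictScalars K ↔ t.MemUpperBound K f :=
      mem_upperClusterAlgebra_iff ht
    have hprod : ∏ k, t.A k ∈ (t.upperClusterAlgebra K).restrictScalars K :=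
      prod_mem fun k _ => ht.A_mem k
    obtain ⟨N, hN⟩ := exists_pow_mul_mem hprod (y' := t.coords K)
      (fun l => hU.2 (ht.memUpperBound_coords l)) (fun l => by
        rcases l with k | i
        · right
          change _ * (t.A k)⁻¹ ∈ _
          rw [← Finset.mul_prod_erase _ _ (Finset.mem_univ k), mul_comm,
            inv_mul_cancel_left₀ (ht.A_ne_zero k)]
          exact prod_mem fun k _ => ht.A_mem k
        · left
          exact hU.2 ⟨inv_mem_laurent _, fun j => t.inv_coords_mem_laurent_mutate (by simp)⟩) s.2
    refine ⟨N, ⟨_, hN⟩, Subtype.ext ?_⟩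
    change ((∏ i, (⟨t.A i, ht.A_mem i⟩ : t.upperClusterAlgebra K) : t.upperClusterAlgebra K) : F)
      ^ N * (s : F) = (∏ k, t.A k) ^ N * s
    simp

end IsNondegenerate

end SeedData

end ClusterAlgebra

open ClusterAlgebra ClusterAlgebra.SeedData in
theorem theorem4p4 {K : Type*} [CommRing K]
    (hK : (IsField K ∧ CharZero K) ∨ Nonempty (K ≃+* ℤ))
    {n m : ℕ} {F : Type*} [Field F] [Algebra (MonoidAlgebra K (Trop m)) F]
    (t₀ : SeedData n (Trop m) F) (ht₀ : t₀.IsSeed K) (hrank : t₀.IsFullRank) :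
    ∃ (hA : ∀ k, t₀.A k ∈ t₀.upperClusterAlgebra K)
      (hP : ∀ k, t₀.exchangeBinomial K k ∈ t₀.omitPolyRing K k),
      List.TFAE [
        UniqueFactorizationMonoid (t₀.upperClusterAlgebra K),
        ∀ k, Prime (⟨t₀.A k, hA k⟩ : t₀.upperClusterAlgebra K),
        ∀ k, ∀ M L : t₀.upperClusterAlgebra K, M ≠ 0 → L ≠ 0 →
          valuationPairing (t₀.upperClusterAlgebra K) (t₀.A k) (M * L) =
            valuationPairing (t₀.upperClusterAlgebra K) (t₀.A k) M +
              valuationPairing (t₀.upperClusterAlgebra K) (t₀.A k) L,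
        ∀ k, Irreducible (⟨t₀.exchangeBinomial K k, hP k⟩ : t₀.omitPolyRing K k)] := by
  obtain ⟨_, _⟩ : ∃ _ : IsDomain K, UniqueFactorizationMonoid K := by
    rcases hK with ⟨hK, -⟩ | ⟨⟨e⟩⟩
    · have := hK.isDomain
      -- In a field every nonzero element is a unit, so the empty multiset of primes suffices.
      refine ⟨this, .of_exists_prime_factors fun a ha => ⟨0, by simp, ?_⟩⟩
      obtain ⟨b, hb⟩ := hK.mul_inv_cancel ha
      simpa using (associated_one_iff_isUnit.2 (IsUnit.of_mul_eq_one b hb)).symm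
    · exact ⟨e.toMulEquiv.isDomain ℤ, e.symm.toMulEquiv.uniqueFactorizationMonoid inferInstance⟩
  let : Algebra K F :=
    ((algebraMap (MonoidAlgebra K (Trop m)) F).comp (algebraMap K _)).toAlgebra
  have : IsScalarTower K (MonoidAlgebra K (Trop m)) F := .of_algebraMap_eq fun _ => rfl
  have ht := ht₀.isNondegenerate hrank
  refine ⟨ht.A_mem, ht.exchangeBinomial_mem, ?_⟩
  tfae_have 1 → 2 := fun _ k => (ht.irreducible_A k).prime
  tfae_have 2 → 1 := ht.uniqueFactorizationMonoid_of_prime_A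
  tfae_have 2 ↔ 3 := forall_congr' fun k => prime_iff_valuationPairing_mul (ht.A_mem k)
    (ht.A_ne_zero k) (ht.inv_A_not_mem_upperClusterAlgebra k)
  tfae_have 2 → 4 := fun h k => ht.irreducible_of_prime_A (h k)
  tfae_have 4 → 2 := fun h k => ht.prime_A_of_irreducible (h k)
  tfae_finish
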